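/- Let $D\ge 0$, $N\ge 1$, $T>0$, let $\mathcal X_0=\{1,\dots,N\}^D$ and let $\mathcal X=\{1,\dots,N,\mathbf M\}^D$, where $\mathbf M$ is the mask token. For $x\in\mathcal X$ write $x^{d\gets n}$ for $x$ with its $d$-th entry replaced by $n$, and $x^{\mathrm{UM}}=(x^d: x^d\ne\mathbf M)$. Let $\pi(x)=\frac1Z e^{-U(x)}$ on $\mathcal X_0$ with $U:\mathcal X_0\to\mathbb R$. Let $\gamma$ be a nonnegative function that is locally integrable on $[0,T)$ with $\int_0^T\gamma(t)\,dt=\infty$. Let $Q^0$ be the generator on $\mathcal X$ with $Q^0_t(x,x^{d\gets n})=\frac{\gamma(t)}N 1_{x^d=\mathbf M}$ whenever $x^{d\gets n}\neq x$, with no other transitions (the diagonal makes row sums zero). Let $r=-U-\log\frac1{N^D}$ on $\mathcal X_0$, extended to $\mathcal X$ by arbitrary real values. A control is a generator $Q^u$ on $\mathcal X$ whose entries are locally integrable functions of $t\in[0,T)$. The cost from $(t,x)$ of a continuous-time Markov chain $X$ on $[t,T]$ with generator $Q^u$ and $X_t=x$ (with càdlàg paths and almost surely no jump at the fixed time $T$)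 is $$J=\mathbb E\Big[\int_t^T\sum_{y\ne X_s}\Big(Q^u_s\log\frac{Q^u_s}{Q^0_s}-Q^u_s+Q^0_s\Big)(X_s,y)\,ds-r(X_T)\Big]\in(-\infty,\infty],$$ where $0\log(0/b)=0$ for $b\ge0$ and $a\log(a/0)=\infty$ for $a>0$. Let $-V_t(x)$ be the infimum of this cost over all controls and all such chains. Then: 1. A chain with generator $Q^0$ started at time $0$ from the fully masked sequence exists; every such chain is memoryless ($X_0$ and $X_T$ are independent), and $X_T$ is uniformly distributed on $\mathcal X_0$. 2. $V_t(x)$ is finite for all $t\in[0,T)$, $x\in\mathcal X$. The generator $Q^*$ with $Q^*_t(x,y)=Q^0_t(x,y)e^{V_t(y)-V_t(x)}$ for $y\neq x$ satisfies $$Q^*_t(x,x^{d\gets n})=\gamma(t)\,\Pr_{X\sim\pi}\big(X^d=n\mid X^{\mathrm{UM}}=x^{\mathrm{UM}}\big)\,1_{x^d=\mathbf M}$$ for all $t\in[0,T)$ and all $x,d,n$ with $x^{d\gets n}\ne x$, and all its other off-diagonal entries vanish. Here the conditioning event is that $X^i=x^i$ for all $i$ with $x^i\ne\mathbf M$. 3.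 $Q^*$ is optimal: for every $(t,x)\in[0,T)\times\mathcal X$ there is a chain with generator $Q^*$ started from $(t,x)$ that attains the minimal cost. In particular it solves the stochastic optimal control problem started at time $0$ from the fully masked sequence. 4. $Q^*$ is the unique solution: if $Q$ is optimal for the problem started at time $0$ from the fully masked sequence, then for almost every $t\in[0,T)$, $Q_t(x,y)=Q^*_t(x,y)$ for all $y\in\mathcal X$ and all $x\in\mathcal X$ such that $x$ is the fully masked sequence or $\int_0^t\gamma(s)\,ds>0$ (if $\int_0^t\gamma(s)\,ds=0$, the other states cannot be reached by time $t$ under $Q^*$). -/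

import Mathlib

open MeasureTheory ProbabilityTheory Filter Topology

noncomputable section

namespace MaskedDiffusion

/-! ### Continuous-time Markov chains on a finite state space -/

section Chains

variable {S : Type} [Fintype S] [DecidableEq S]

/-- The matrix with the same off-diagonal entries as `R` and with rows summing to zero. -/
def rateMatrix (R : S → S → ℝ) (x y : S) : ℝ :=
  if y = x then -∑ z ∈ Finset.univ.erase x, R x z else R x y

/-- `Q` is a time-dependent generator on `[0, T)`: nonnegative off-diagonal rates, zero row sums,
and entries that are measurable and integrable on every `[0, t]`, `t < T`. The rates may blow up
at the terminal time `T`. -/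
structure IsGenerator (T : ℝ) (Q : ℝ → S → S → ℝ) : Prop where
  nonneg : ∀ t ∈ Set.Ico 0 T, ∀ x y, x ≠ y → 0 ≤ Q t x y
  row_sum : ∀ t ∈ Set.Ico 0 T, ∀ x, ∑ y, Q t x y = 0
  locallyIntegrable : ∀ x y, LocallyIntegrableOn (fun t => Q t x y) (Set.Ico 0 T) volume

/-- The `σ`-algebra generated by `X u`, `t₀ ≤ u ≤ s`. -/
@[reducible]
def history {Ω : Type} (X : ℝ → Ω → S) (t₀ s : ℝ) : MeasurableSpace Ω :=
  MeasurableSpace.generateFrom {B | ∃ u ∈ Set.Icc t₀ s, ∃ x, B = {ω | X u ω = x}}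

/-- `(X t)`, `t₀ ≤ t ≤ T`, is under `P` a continuous-time Markov chain with generator `Q` that
starts from `x₀` at time `t₀`. The Markov property and the generator are expressed through the
(well-posed) martingale problem: for every `y`, the process
`1_{X t = y} - ∫_{t₀}^t Q_u(X u, y) du` is a martingale on `[t₀, T)` for the history of `X`; this is
the Kolmogorov forward equation conditionally on the past, and gives
`Pr(X_{t+h} = y | X_t = x) = 1_{x = y} + h Q_t(x, y) + o(h)` for rates continuous in time.
There is no fixed-time jump at `T`. -/
structure IsCTMC {Ω : Type} [MeasurableSpace Ω] (T : ℝ) (Q : ℝ → S → S → ℝ) (t₀ : ℝ) (x₀ : S)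
    (P : Measure Ω) (X : ℝ → Ω → S) : Prop where
  prob : IsProbabilityMeasure P
  meas : ∀ t ∈ Set.Icc t₀ T, ∀ x, MeasurableSet {ω | X t ω = x}
  right_cont : ∀ ω, ∀ t ∈ Set.Ico t₀ T, ∀ᶠ s in 𝓝[>] t, X s ω = X t ω
  left_lim : ∀ ω, ∀ t ∈ Set.Ioc t₀ T, ∃ y, ∀ᶠ s in 𝓝[<] t, X s ω = y
  start : ∀ᵐ ω ∂P, X t₀ ω = x₀
  forward : ∀ s t, t₀ ≤ s → s ≤ t → t < T → ∀ A, MeasurableSet[history X t₀ s] A → ∀ y,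
    P.real (A ∩ {ω | X t ω = y}) - P.real (A ∩ {ω | X s ω = y})
      = ∫ u in s..t, ∑ x, P.real (A ∩ {ω | X u ω = x}) * Q u x y
  terminal : ∀ᵐ ω ∂P, ∀ᶠ s in 𝓝[<] T, X s ω = X T ω

/-! ### The stochastic optimal control problem -/

/-- `a log (a / b) - a + b ∈ [0, ∞]` for `a, b ≥ 0`, with `0 log (0 / b) = 0` and
`a log (a / 0) = ∞` for `a > 0`. -/
def rateDivergence (a b : ℝ) : ENNReal :=
  if b = 0 ∧ a ≠ 0 then ⊤ else ENNReal.ofReal (a * Real.log (a / b) - a + b)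

/-- The cost `E [∫_{t₀}^T ∑_{y ≠ X_t} (Q log (Q / Q⁰) - Q + Q⁰)(X_t, y) dt - r(X_T)]`. -/
def controlCost {Ω : Type} [MeasurableSpace Ω] (T : ℝ) (Q₀ : ℝ → S → S → ℝ) (r : S → ℝ)
    (t₀ : ℝ) (Q : ℝ → S → S → ℝ) (P : Measure Ω) (X : ℝ → Ω → S) : EReal :=
  ((∫⁻ ω, (∫⁻ t in Set.Ico t₀ T,
      ∑ y ∈ Finset.univ.erase (X t ω), rateDivergence (Q t (X t ω) y) (Q₀ t (X t ω) y)) ∂P :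
        ENNReal) : EReal)
    - ((∫ ω, r (X T ω) ∂P : ℝ) : EReal)

/-- The costs of all controlled chains started from `x₀` at time `t₀`. -/
def attainableCosts (T : ℝ) (Q₀ : ℝ → S → S → ℝ) (r : S → ℝ) (t₀ : ℝ) (x₀ : S) : Set EReal :=
  {c | ∃ Q : ℝ → S → S → ℝ, IsGenerator T Q ∧
    ∃ (Ω : Type) (_ : MeasurableSpace Ω) (P : Measure Ω) (X : ℝ → Ω → S),
      IsCTMC T Q t₀ x₀ P X ∧ c = controlCost T Q₀ r t₀ Q P X}

/-- `Q` solves the control problem started from `x₀` at time `t₀`: there is a chain with generator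
`Q`, and its cost is the least among all controlled chains. -/
def IsOptimal (T : ℝ) (Q₀ : ℝ → S → S → ℝ) (r : S → ℝ) (t₀ : ℝ) (x₀ : S)
    (Q : ℝ → S → S → ℝ) : Prop :=
  IsGenerator T Q ∧ ∃ (Ω : Type) (_ : MeasurableSpace Ω) (P : Measure Ω) (X : ℝ → Ω → S),
    IsCTMC T Q t₀ x₀ P X ∧
      IsLeast (attainableCosts T Q₀ r t₀ x₀) (controlCost T Q₀ r t₀ Q P X)

/-- The value function `V_t(x)`, where `-V_t(x)` is the infimum of the cost from `(t, x)`. -/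
def valueFunction (T : ℝ) (Q₀ : ℝ → S → S → ℝ) (r : S → ℝ) (t : ℝ) (x : S) : EReal :=
  -sInf (attainableCosts T Q₀ r t x)

/-- The generator with off-diagonal entries `Q⁰_t(x, y) exp (V_t(y) - V_t(x))`. -/
def tiltedGenerator (Q₀ : ℝ → S → S → ℝ) (V : ℝ → S → ℝ) (t : ℝ) : S → S → ℝ :=
  rateMatrix fun x y => Q₀ t x y * Real.exp (V t y - V t x)

end Chains

/-! ### Masked sequences -/

section Masked

variable {D N : ℕ}

/-- Masked sequences; the mask token is `none`. -/
abbrev State (D N : ℕ) : Type := Fin D → Option (Fin N)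

/-- The inclusion of unmasked sequences into masked sequences. -/
def embed (z : Fin D → Fin N) : State D N := fun d => some (z d)

/-- The fully masked sequence. -/
def fullMask (D N : ℕ) : State D N := fun _ => none

/-- The sequence obtained from `x` by replacing its entry at position `d` by the token `n`. -/
def setToken (x : State D N) (d : Fin D) (n : Fin N) : State D N := Function.update x d (some n)

/-- The masked-diffusion reference generator: each masked position is replaced by each token at
rate `γ t / N`, and there are no other transitions. -/
def maskGenerator (D N : ℕ) (γ : ℝ → ℝ) (t : ℝ) : State D N → State D N → ℝ :=
  open Classical in
  rateMatrix fun x y => if ∃ d n, x d = none ∧ y = setToken x d n then γ t / N else 0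

/-- The target distribution `π(z) = exp (-U z) / Z`. -/
def target (U : (Fin D → Fin N) → ℝ) : Measure (Fin D → Fin N) :=
  ∑ z, ENNReal.ofReal (Real.exp (-U z) / ∑ w, Real.exp (-U w)) • Measure.dirac z

/-- The event that an unmasked sequence agrees with `x` at every unmasked position of `x`. -/
def agrees (x : State D N) : Set (Fin D → Fin N) := {z | ∀ d, x d ≠ none → x d = some (z d)}

/-- `Pr_{X ∼ π}(X^d = n | X^{UM} = x^{UM})`. -/
def condMarginal (U : (Fin D → Fin N) → ℝ) (x : State D N) (d : Fin D) (n : Fin N) : ℝ :=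
  ((target U)[|agrees x]).real {z | z d = n}

end Masked

end MaskedDiffusion

end

set_option linter.unusedSectionVars false

namespace MaskedDiffusion

/-! ### The rate divergence -/

/-! The problem is a Gibbs variational principle, solved by verification. Take a test function f on
the states. Fenchel–Young for a ↦ a log (a / b) - a + b, applied to every jump rate and combined
with Dynkin's formula, bounds the running cost below by the increment of the mean of f minus its
integrated exponential drift (`IsCTMC.le_runningCost`). For each rate, equality forces Q⁰ exp (f y -
f x). Rates are integrable only away from T, so everything is done on [t₀, t], and t → T is taken at
the end.

The right f is `potential U`. Its exponential is proportional to the mean of exp (-U) over the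
completions of a sequence, and this mean is harmonic because fixing one masked token partitions the
completions (`sum_completionMean_setToken`). So the drift vanishes for every schedule and f does not
depend on time. On unmasked sequences f equals the reward. On masked sequences the reward is
arbitrary, so a second argument is needed: with the number of masks as test function, the drift is
-(1 - e⁻¹) γ times that number, and since γ has infinite mass, a positive mean number of masks at T
would cost infinitely much (`IsCTMC.mean_card_masked_eq_zero`).

Attainment needs a chain with the tilted rates. It is explicit (`isCTMC_unmaskPath`): draw a full
sequence from the target conditioned on the initial tokens, and reveal each masked position when the
clock ∫ γ passes an independent exponential time. The case U = 0 is the reference chain. Its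
terminal law, for any realization, follows from the harmonicity of completion means
(`IsCTMC.uniform_terminal`).

For uniqueness, a minimizer has no gap in the verification inequality, hence has the tilted rates in
every occupied state (`IsCTMC.ae_eq_tilted`). The forward equation with an integrating factor then
shows, by induction on the number of revealed tokens, that every state is occupied once the clock is
positive (`IsCTMC.prob_pos`). -/

lemma rateDivergence_eq {a b : ℝ} (h : b = 0 → a = 0) :
    rateDivergence a b = ENNReal.ofReal (a * Real.log (a / b) - a + b) := by
  unfold rateDivergence
  rw [if_neg]
  rintro ⟨h1, h2⟩
  exact h2 (h h1)

lemma eq_zero_of_rateDivergence_ne_top {a b : ℝ} (h : rateDivergence a b ≠ ⊤) :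
    b = 0 → a = 0 := by
  intro hb
  by_contra ha
  exact h (by simp [rateDivergence, hb, ha])

/-- The Fenchel–Young gap is a (z - 1 - log z) with z = b exp l / a. It is therefore nonnegative,
and zero only at z = 1, which gives both the inequality and its equality case. -/
lemma log_exp_div_identity {a b l : ℝ} (ha : 0 < a) (hb : 0 < b) :
    a * Real.log (a / b) - a + b - (l * a - b * (Real.exp l - 1))
      = a * (b * Real.exp l / a - 1 - Real.log (b * Real.exp l / a)) := by
  have hl := Real.exp_pos l
  rw [Real.log_div ha.ne' hb.ne', Real.log_div (by positivity) ha.ne',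
    Real.log_mul hb.ne' hl.ne', Real.log_exp]
  field_simp
  ring

/-- The Fenchel–Young inequality for the relative entropy of Poisson rates. -/
lemma fenchel_young_rate {a b : ℝ} (ha : 0 ≤ a) (hb : 0 ≤ b) (h : b = 0 → a = 0) (l : ℝ) :
    l * a - b * (Real.exp l - 1) ≤ a * Real.log (a / b) - a + b := by
  rcases ha.eq_or_lt with rfl | ha
  · have := mul_nonneg hb (Real.exp_pos l).le
    simp only [mul_zero, zero_div, Real.log_zero]
    nlinarith
  · have hb : 0 < b := lt_of_le_of_ne hb fun h0 => ha.ne' (h h0.symm)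
    have h1 := log_exp_div_identity (l := l) ha hb
    have h2 := Real.log_le_sub_one_of_pos (x := b * Real.exp l / a) (by positivity)
    nlinarith [mul_nonneg ha.le (sub_nonneg.2 h2)]

/-- The equality case of the Fenchel–Young inequality. -/
lemma fenchel_young_rate_eq {a b : ℝ} (ha : 0 ≤ a) (hb : 0 ≤ b) (h : b = 0 → a = 0) {l : ℝ}
    (heq : a * Real.log (a / b) - a + b = l * a - b * (Real.exp l - 1)) :
    a = b * Real.exp l := by
  rcases ha.eq_or_lt with rfl | ha
  · simp only [mul_zero, zero_div, Real.log_zero] at heq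
    linarith
  · have hb : 0 < b := lt_of_le_of_ne hb fun h0 => ha.ne' (h h0.symm)
    have h1 := log_exp_div_identity (l := l) ha hb
    by_contra hne
    have h2 := Real.log_lt_sub_one_of_pos (x := b * Real.exp l / a) (by positivity)
      (fun h => hne (by field_simp at h; exact h.symm))
    nlinarith [mul_pos ha (sub_pos.2 h2)]

lemma rateDivergence_mul_exp {b : ℝ} (hb : 0 ≤ b) (l : ℝ) :
    rateDivergence (b * Real.exp l) b
      = ENNReal.ofReal (l * (b * Real.exp l) - b * (Real.exp l - 1)) := by
  rw [rateDivergence_eq (by rintro rfl; simp)]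
  congr 1
  rcases hb.eq_or_lt with rfl | hb
  · simp
  · rw [mul_div_right_comm, div_self hb.ne', one_mul, Real.log_exp]
    ring

/-- The truncation by `ENNReal.ofReal` costs nothing, as the divergence is nonnegative, and the
infinite case b = 0 < a is trivially fine. No absolute continuity of the rates is needed. -/
lemma ofReal_le_rateDivergence {a b : ℝ} (ha : 0 ≤ a) (hb : 0 ≤ b) (l : ℝ) :
    ENNReal.ofReal (l * a - b * (Real.exp l - 1)) ≤ rateDivergence a b := by
  by_cases h : rateDivergence a b = ⊤
  · simp [h]
  · have h' := eq_zero_of_rateDivergence_ne_top h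
    rw [rateDivergence_eq h']
    exact ENNReal.ofReal_le_ofReal (fenchel_young_rate ha hb h' l)

lemma measurable_rateDivergence : Measurable fun p : ℝ × ℝ => rateDivergence p.1 p.2 := by
  unfold rateDivergence
  refine Measurable.ite ?_ measurable_const ?_
  · exact (measurable_snd (measurableSet_singleton (0 : ℝ))).inter
      ((measurable_fst (measurableSet_singleton (0 : ℝ))).compl)
  · fun_prop

lemma ofReal_sum_le {ι : Type*} (s : Finset ι) (f : ι → ℝ) :
    ENNReal.ofReal (∑ i ∈ s, f i) ≤ ∑ i ∈ s, ENNReal.ofReal (f i) :=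
  Finset.le_sum_of_subadditive _ ENNReal.ofReal_zero.le (fun _ _ => ENNReal.ofReal_add_le) _ _

/-! ### Running cost rates and their linear lower bounds -/

section Chains

variable {S : Type} [Fintype S] [DecidableEq S]

/-- The running cost rate `∑_{y ≠ x} (Q log (Q / Q⁰) - Q + Q⁰)(x, y)` in state `x`. -/
noncomputable def costRate (Q Q₀ : ℝ → S → S → ℝ) (t : ℝ) (x : S) : ENNReal :=
  ∑ y ∈ Finset.univ.erase x, rateDivergence (Q t x y) (Q₀ t x y)

/-- `∑_{y ≠ x} (Q (f y - f x) - Q⁰ (exp (f y - f x) - 1))(x, y)`, the linear lower bound of the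
running cost rate that belongs to the test function `f`. -/
noncomputable def dualRate (Q Q₀ : ℝ → S → S → ℝ) (f : S → ℝ) (t : ℝ) (x : S) : ℝ :=
  ∑ y ∈ Finset.univ.erase x,
    ((f y - f x) * Q t x y - Q₀ t x y * (Real.exp (f y - f x) - 1))

variable {T : ℝ} {Q Q₀ : ℝ → S → S → ℝ}

lemma ofReal_dualRate_le_costRate (hQ : IsGenerator T Q) (hQ₀ : IsGenerator T Q₀) (f : S → ℝ)
    {t : ℝ} (ht : t ∈ Set.Ico 0 T) (x : S) :
    ENNReal.ofReal (dualRate Q Q₀ f t x) ≤ costRate Q Q₀ t x := by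
  refine (ofReal_sum_le _ _).trans (Finset.sum_le_sum fun y hy => ?_)
  have hxy : x ≠ y := (Finset.ne_of_mem_erase hy).symm
  exact ofReal_le_rateDivergence (hQ.nonneg t ht x y hxy) (hQ₀.nonneg t ht x y hxy) _

/-- The Fenchel–Young inequalities hold term by term, so equality of the finite sums forces equality
in each term. -/
lemma eq_of_costRate_eq_dualRate (hQ : IsGenerator T Q) (hQ₀ : IsGenerator T Q₀) (f : S → ℝ)
    {t : ℝ} (ht : t ∈ Set.Ico 0 T) (x : S) (htop : costRate Q Q₀ t x ≠ ⊤)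
    (h : (costRate Q Q₀ t x).toReal ≤ dualRate Q Q₀ f t x) {y : S} (hy : y ≠ x) :
    Q t x y = Q₀ t x y * Real.exp (f y - f x) := by
  have hfin : ∀ y ∈ Finset.univ.erase x, rateDivergence (Q t x y) (Q₀ t x y) ≠ ⊤ := by
    simpa [costRate, ENNReal.sum_eq_top] using htop
  have hpt : ∀ y ∈ Finset.univ.erase x,
      (f y - f x) * Q t x y - Q₀ t x y * (Real.exp (f y - f x) - 1)
        ≤ (rateDivergence (Q t x y) (Q₀ t x y)).toReal := by
    intro y hy
    have hxy : x ≠ y := (Finset.ne_of_mem_erase hy).symm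
    exact (ENNReal.ofReal_le_iff_le_toReal (hfin y hy)).1
      (ofReal_le_rateDivergence (hQ.nonneg t ht x y hxy) (hQ₀.nonneg t ht x y hxy) _)
  have hy' : y ∈ Finset.univ.erase x := by simp [hy]
  have hsum : (costRate Q Q₀ t x).toReal
      = ∑ y ∈ Finset.univ.erase x, (rateDivergence (Q t x y) (Q₀ t x y)).toReal :=
    ENNReal.toReal_sum hfin
  have heq := (Finset.sum_eq_sum_iff_of_le hpt).1
    (le_antisymm (Finset.sum_le_sum hpt) (hsum ▸ h)) y hy'
  have h0 := eq_zero_of_rateDivergence_ne_top (hfin y hy')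
  have hn := hQ.nonneg t ht x y hy.symm
  have hn0 := hQ₀.nonneg t ht x y hy.symm
  refine fenchel_young_rate_eq hn hn0 h0 ?_
  rw [heq, rateDivergence_eq h0, ENNReal.toReal_ofReal]
  have := fenchel_young_rate hn hn0 h0 0
  simpa using this

lemma IsGenerator.integrableOn_Icc (hQ : IsGenerator T Q) {s t : ℝ} (hs : 0 ≤ s) (ht : t < T)
    (x y : S) : IntegrableOn (fun u => Q u x y) (Set.Icc s t) := by
  refine (hQ.locallyIntegrable x y).integrableOn_compact_subset ?_ isCompact_Icc
  exact fun u hu => ⟨hs.trans hu.1, hu.2.trans_lt ht⟩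

lemma IsGenerator.aemeasurable (hQ : IsGenerator T Q) (x y : S) {t₀ : ℝ} (h0 : 0 ≤ t₀) :
    AEMeasurable (fun u => Q u x y) (volume.restrict (Set.Ico t₀ T)) :=
  ((hQ.locallyIntegrable x y).aestronglyMeasurable.aemeasurable).mono_set
    (Set.Ico_subset_Ico_left h0)

lemma aemeasurable_costRate (hQ : IsGenerator T Q) (hQ₀ : IsGenerator T Q₀) (x : S) {t₀ : ℝ}
    (h0 : 0 ≤ t₀) :
    AEMeasurable (fun u => costRate Q Q₀ u x) (volume.restrict (Set.Ico t₀ T)) := by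
  unfold costRate
  refine Finset.aemeasurable_fun_sum _ fun y _ => ?_
  exact measurable_rateDivergence.comp_aemeasurable
    ((hQ.aemeasurable x y h0).prodMk (hQ₀.aemeasurable x y h0))

lemma integrableOn_dualRate (hQ : IsGenerator T Q) (hQ₀ : IsGenerator T Q₀) (f : S → ℝ) (x : S)
    {s t : ℝ} (hs : 0 ≤ s) (ht : t < T) :
    IntegrableOn (fun u => dualRate Q Q₀ f u x) (Set.Icc s t) := by
  unfold dualRate
  refine integrable_finsetSum _ fun y _ => ?_
  exact ((hQ.integrableOn_Icc hs ht x y).const_mul _).sub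
    ((hQ₀.integrableOn_Icc hs ht x y).mul_const _)

lemma IsGenerator.sum_mul (hQ : IsGenerator T Q) (f : S → ℝ) {t : ℝ} (ht : t ∈ Set.Ico 0 T)
    (x : S) : ∑ y, Q t x y * f y = ∑ y ∈ Finset.univ.erase x, (f y - f x) * Q t x y := by
  have h1 : ∑ y, Q t x y * f y = ∑ y, (f y - f x) * Q t x y := by
    have : ∑ y, (f y - f x) * Q t x y = ∑ y, Q t x y * f y - f x * ∑ y, Q t x y := by
      rw [Finset.mul_sum, ← Finset.sum_sub_distrib]
      exact Finset.sum_congr rfl fun y _ => by ring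
    rw [this, hQ.row_sum t ht x]
    ring
  rw [h1, ← Finset.add_sum_erase _ _ (Finset.mem_univ x)]
  simp

end Chains

/-! ### Path measurability, one-dimensional marginals and Dynkin's formula -/

section Chains

variable {S : Type} [Fintype S] [DecidableEq S] {T t₀ : ℝ} {Q : ℝ → S → S → ℝ} {x₀ : S}
  {Ω : Type} [MeasurableSpace Ω] {P : Measure Ω} {X : ℝ → Ω → S}

/-- A right-continuous process is jointly measurable. -/
lemma IsCTMC.measurableSet_graph (hX : IsCTMC T Q t₀ x₀ P X) (x : S) :
    MeasurableSet {p : Ω × ℝ | p.2 ∈ Set.Ico t₀ T ∧ X p.2 p.1 = x} := by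
  rcases lt_or_ge T t₀ with h | h
  · simp [Set.Ico_eq_empty_of_le h.le]
  -- The right end of the mesh cell of width 1 / (n + 1) containing t, capped at T. Floor plus one,
  -- rather than the ceiling, keeps it strictly to the right of t, as `right_cont` speaks of 𝓝[>] t.
  set d : ℕ → ℝ → ℝ := fun n t => min T (t₀ + (⌊(t - t₀) * (n + 1)⌋₊ + 1) / (n + 1)) with hd
  have hgt : ∀ t ∈ Set.Ico t₀ T, ∀ n, t < d n t := by
    intro t ht n
    refine lt_min ht.2 ?_
    have h1 := Nat.lt_floor_add_one ((t - t₀) * (n + 1))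
    have hn : (0 : ℝ) < n + 1 := by positivity
    have : t - t₀ < (⌊(t - t₀) * (n + 1)⌋₊ + 1) / (n + 1) := by
      rw [lt_div_iff₀ hn]
      exact h1
    linarith
  have hle : ∀ t ∈ Set.Ico t₀ T, ∀ n : ℕ, d n t ≤ t + 1 / ((n : ℝ) + 1) := by
    intro t ht n
    refine (min_le_right _ _).trans ?_
    have hn : (0 : ℝ) < n + 1 := by positivity
    have h1 := Nat.floor_le (mul_nonneg (sub_nonneg.2 ht.1) hn.le)
    have : ((⌊(t - t₀) * (n + 1)⌋₊ : ℝ) + 1) / (n + 1) ≤ (t - t₀) + 1 / (n + 1) := by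
      rw [add_div]
      gcongr
      rwa [div_le_iff₀ hn]
    linarith
  have hlim : ∀ t ∈ Set.Ico t₀ T, Tendsto (fun n => d n t) atTop (𝓝[>] t) := by
    intro t ht
    refine tendsto_nhdsWithin_iff.2 ⟨?_, Eventually.of_forall fun n => hgt t ht n⟩
    refine tendsto_of_tendsto_of_tendsto_of_le_of_le tendsto_const_nhds ?_
      (fun n => (hgt t ht n).le) (fun n => hle t ht n)
    simpa using tendsto_const_nhds.add (tendsto_one_div_add_atTop_nhds_zero_nat (𝕜 := ℝ))
  have hmeas : ∀ n, MeasurableSet {p : Ω × ℝ | p.2 ∈ Set.Ico t₀ T ∧ X (d n p.2) p.1 = x} := by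
    intro n
    have : {p : Ω × ℝ | p.2 ∈ Set.Ico t₀ T ∧ X (d n p.2) p.1 = x}
        = ⋃ k : ℕ, {p : Ω × ℝ | X (min T (t₀ + ((k : ℝ) + 1) / (n + 1))) p.1 = x} ∩
          {p : Ω × ℝ | p.2 ∈ Set.Ico t₀ T ∧ ⌊(p.2 - t₀) * (n + 1)⌋₊ = k} := by
      ext p
      simp only [Set.mem_ofPred_eq, Set.mem_iUnion, Set.mem_inter_iff, hd]
      constructor
      · rintro ⟨h1, h2⟩
        exact ⟨_, h2, h1, rfl⟩
      · rintro ⟨k, h2, h1, rfl⟩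
        exact ⟨h1, h2⟩
    rw [this]
    refine MeasurableSet.iUnion fun k => MeasurableSet.inter ?_ ?_
    · refine measurable_fst (hX.meas _ ⟨le_min h ?_, min_le_left _ _⟩ x)
      have : (0 : ℝ) ≤ ((k : ℝ) + 1) / (n + 1) := by positivity
      linarith
    · have hf : Measurable fun u : ℝ => ⌊(u - t₀) * ((n : ℝ) + 1)⌋₊ :=
        Nat.measurable_floor.comp (by fun_prop)
      exact (measurable_snd measurableSet_Ico).inter
        ((hf.comp measurable_snd) (measurableSet_singleton k))
  -- The state space is discrete, so X at the mesh points is eventually equal to X t, and the graph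
  -- is a set-theoretic liminf.
  have : {p : Ω × ℝ | p.2 ∈ Set.Ico t₀ T ∧ X p.2 p.1 = x}
      = liminf (fun n => {p : Ω × ℝ | p.2 ∈ Set.Ico t₀ T ∧ X (d n p.2) p.1 = x}) atTop := by
    ext p
    rw [Filter.mem_liminf_iff_eventually_mem]
    simp only [Set.mem_ofPred_eq]
    constructor
    · rintro ⟨h1, h2⟩
      filter_upwards [(hlim _ h1).eventually (hX.right_cont p.1 p.2 h1)] with n hn
      exact ⟨h1, hn.trans h2⟩
    · intro h
      obtain ⟨n, h1, -⟩ := h.exists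
      obtain ⟨n, h3, h2⟩ :=
        (((hlim _ h1).eventually (hX.right_cont p.1 p.2 h1)).and h).exists
      exact ⟨h1, h3.symm.trans h2.2⟩
  rw [this]
  exact MeasurableSet.measurableSet_liminf hmeas

/-- Tonelli, after splitting the integrand over the states: only a.e. measurability in time is
available for each c · x, and the graphs of X supply joint measurability. -/
lemma IsCTMC.lintegral_path (hX : IsCTMC T Q t₀ x₀ P X) (c : ℝ → S → ENNReal)
    (hc : ∀ x, AEMeasurable (fun t => c t x) (volume.restrict (Set.Ico t₀ T))) :
    ∫⁻ ω, (∫⁻ t in Set.Ico t₀ T, c t (X t ω)) ∂P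
      = ∫⁻ t in Set.Ico t₀ T, ∑ x, P {ω | X t ω = x} * c t x := by
  have := hX.prob
  set F : Ω → ℝ → ENNReal := fun ω t =>
    ∑ x, {p : Ω × ℝ | p.2 ∈ Set.Ico t₀ T ∧ X p.2 p.1 = x}.indicator (fun p => c p.2 x) (ω, t)
    with hF
  have h1 : ∀ ω, ∀ t ∈ Set.Ico t₀ T, c t (X t ω) = F ω t := by
    intro ω t ht
    simp only [hF, Set.indicator_apply, Set.mem_ofPred_eq, ht, true_and]
    simp
  have h2 : ∀ ω, ∫⁻ t in Set.Ico t₀ T, c t (X t ω) = ∫⁻ t in Set.Ico t₀ T, F ω t :=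
    fun ω => setLIntegral_congr_fun measurableSet_Ico (h1 ω)
  have h3 : AEMeasurable (Function.uncurry F) (P.prod (volume.restrict (Set.Ico t₀ T))) := by
    have : Function.uncurry F = fun q => ∑ x,
        {p : Ω × ℝ | p.2 ∈ Set.Ico t₀ T ∧ X p.2 p.1 = x}.indicator (fun p => c p.2 x) q := by
      ext ⟨ω, t⟩
      rfl
    rw [this]
    refine Finset.aemeasurable_fun_sum _ fun x _ => ?_
    exact (hc x).comp_snd.indicator (hX.measurableSet_graph x)
  simp only [h2]
  rw [lintegral_lintegral_swap h3]
  refine setLIntegral_congr_fun measurableSet_Ico fun t ht => ?_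
  have h4 : ∀ ω, F ω t = ∑ x, {ω | X t ω = x}.indicator (fun _ => c t x) ω := by
    intro ω
    simp only [hF, Set.indicator_apply, Set.mem_ofPred_eq, ht, true_and]
  have hm : ∀ x, MeasurableSet {ω | X t ω = x} :=
    fun x => hX.meas t ⟨ht.1, ht.2.le⟩ x
  simp only [h4]
  rw [lintegral_finsetSum _ fun x _ => measurable_const.indicator (hm x)]
  refine Finset.sum_congr rfl fun x _ => ?_
  rw [lintegral_indicator_const (hm x), mul_comm]

lemma IsCTMC.aemeasurable_measure (hX : IsCTMC T Q t₀ x₀ P X) (x : S) :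
    AEMeasurable (fun t => P {ω | X t ω = x}) (volume.restrict (Set.Ico t₀ T)) := by
  have := hX.prob
  refine ⟨_, measurable_measure_prodMk_right (μ := P) (hX.measurableSet_graph x), ?_⟩
  filter_upwards [ae_restrict_mem measurableSet_Ico] with t ht
  congr 1
  ext ω
  simp [ht.1, ht.2]

lemma IsCTMC.aestronglyMeasurable_real (hX : IsCTMC T Q t₀ x₀ P X) (x : S) :
    AEStronglyMeasurable (fun t => P.real {ω | X t ω = x}) (volume.restrict (Set.Ico t₀ T)) :=
  (hX.aemeasurable_measure x).ennreal_toReal.aestronglyMeasurable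

lemma IsCTMC.integrableOn_real_mul (hX : IsCTMC T Q t₀ x₀ P X) (x : S) {g : ℝ → ℝ} {s t : ℝ}
    (hs : t₀ ≤ s) (ht : t < T) (hg : IntegrableOn g (Set.Icc s t)) :
    IntegrableOn (fun u => P.real {ω | X u ω = x} * g u) (Set.Icc s t) := by
  have := hX.prob
  refine Integrable.bdd_mul (c := 1) hg ?_ (Eventually.of_forall fun u => ?_)
  · have hsub : Set.Icc s t ⊆ Set.Ico t₀ T := fun u hu => ⟨hs.trans hu.1, hu.2.trans_lt ht⟩
    exact (hX.aestronglyMeasurable_real x).mono_set hsub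
  · rw [Real.norm_of_nonneg measureReal_nonneg]
    exact measureReal_le_one

/-- The mean of `f (X t)`. -/
def mean (P : Measure Ω) (X : ℝ → Ω → S) (f : S → ℝ) (t : ℝ) : ℝ :=
  ∑ x, P.real {ω | X t ω = x} * f x

lemma IsCTMC.integral_comp (hX : IsCTMC T Q t₀ x₀ P X) (f : S → ℝ) {t : ℝ}
    (ht : t ∈ Set.Icc t₀ T) : ∫ ω, f (X t ω) ∂P = mean P X f t := by
  have := hX.prob
  have h4 : ∀ ω, f (X t ω) = ∑ x, {ω | X t ω = x}.indicator (fun _ => f x) ω := by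
    intro ω
    simp [Set.indicator_apply]
  simp only [h4]
  rw [integral_finsetSum]
  · refine Finset.sum_congr rfl fun x _ => ?_
    rw [integral_indicator_const _ (hX.meas t ht x), smul_eq_mul]
  · exact fun x _ => (integrable_const _).indicator (hX.meas t ht x)

lemma IsCTMC.mean_start (hX : IsCTMC T Q t₀ x₀ P X) (f : S → ℝ) : mean P X f t₀ = f x₀ := by
  have := hX.prob
  have h : ∀ x, P.real {ω | X t₀ ω = x} = if x₀ = x then 1 else 0 := by
    intro x
    have : {ω | X t₀ ω = x} =ᵐ[P] {_ω | x₀ = x} := by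
      filter_upwards [hX.start] with ω hω
      change (X t₀ ω = x) = (x₀ = x)
      rw [hω]
    rw [measureReal_congr this]
    split_ifs with hx <;> simp [hx]
  simp [mean, h]

/-- The means of a function converge at the terminal time. -/
lemma IsCTMC.tendsto_mean (hX : IsCTMC T Q t₀ x₀ P X) (h : t₀ < T) (f : S → ℝ) :
    Tendsto (mean P X f) (𝓝[<] T) (𝓝 (mean P X f T)) := by
  have := hX.prob
  refine tendsto_finsetSum _ fun x _ => Tendsto.mul_const _ ?_
  have hev : ∀ᶠ s in 𝓝[<] T, s ∈ Set.Icc t₀ T := by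
    filter_upwards [Ioo_mem_nhdsLT h] with s hs
    exact ⟨hs.1.le, hs.2.le⟩
  -- The condition on s empties the events outside [t₀, T], where X is not known to be measurable.
  have key := tendsto_measure_of_ae_tendsto_indicator (𝓝[<] T) (μ := P)
    (As := fun s => {ω | s ∈ Set.Icc t₀ T ∧ X s ω = x}) (A := {ω | X T ω = x})
    (hX.meas T ⟨h.le, le_rfl⟩ x) (fun s => ?_) MeasurableSet.univ (measure_ne_top _ _)
    (Eventually.of_forall fun _ => Set.subset_univ _) ?_
  · have h2 := (ENNReal.tendsto_toReal (measure_ne_top _ _)).comp key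
    refine h2.congr' ?_
    filter_upwards [hev] with s hs
    simp [Measure.real, hs.1, hs.2]
  · by_cases hs : s ∈ Set.Icc t₀ T
    · simpa only [hs, true_and] using hX.meas s hs x
    · simp [hs]
  · filter_upwards [hX.terminal] with ω hω
    filter_upwards [hω, hev] with s h1 h2
    simp [h2.1, h2.2, h1]

/-- Dynkin's formula. -/
lemma IsCTMC.dynkin (hX : IsCTMC T Q t₀ x₀ P X) (hQ : IsGenerator T Q) (h0 : 0 ≤ t₀) (f : S → ℝ)
    {s t : ℝ} (hs : t₀ ≤ s) (hst : s ≤ t) (ht : t < T) :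
    mean P X f t - mean P X f s
      = ∫ u in s..t, ∑ x, P.real {ω | X u ω = x} * ∑ y, Q u x y * f y := by
  have hfwd : ∀ y, P.real {ω | X t ω = y} - P.real {ω | X s ω = y}
      = ∫ u in s..t, ∑ x, P.real {ω | X u ω = x} * Q u x y := by
    intro y
    -- Only the unconditional forward equation, with the trivial past event, is needed here.
    simpa using hX.forward s t hs hst ht Set.univ MeasurableSet.univ y
  have hint : ∀ y, IntervalIntegrable
      (fun u => ∑ x, P.real {ω | X u ω = x} * Q u x y) volume s t := by
    intro y
    rw [intervalIntegrable_iff_integrableOn_Icc_of_le hst]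
    exact integrable_finsetSum _ fun x _ => hX.integrableOn_real_mul x hs ht
      (hQ.integrableOn_Icc (h0.trans hs) ht x y)
  unfold mean
  rw [← Finset.sum_sub_distrib]
  simp only [← sub_mul, hfwd, ← intervalIntegral.integral_mul_const]
  rw [← intervalIntegral.integral_finsetSum fun y _ => (hint y).mul_const _]
  congr 1
  ext u
  simp only [Finset.sum_mul, Finset.mul_sum]
  rw [Finset.sum_comm]
  exact Finset.sum_congr rfl fun x _ => Finset.sum_congr rfl fun y _ => by ring

end Chains

/-! ### The verification inequality and its equality case -/

section Chains

variable {S : Type} [Fintype S] [DecidableEq S] {T t₀ : ℝ} {Q Q₀ : ℝ → S → S → ℝ} {x₀ : S}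
  {Ω : Type} [MeasurableSpace Ω] {P : Measure Ω} {X : ℝ → Ω → S}

/-- `∑_{y ≠ x} Q⁰(x, y) (exp (f y - f x) - 1)`, which vanishes when `exp f` is harmonic. -/
noncomputable def expDrift (Q₀ : ℝ → S → S → ℝ) (f : S → ℝ) (t : ℝ) (x : S) : ℝ :=
  ∑ y ∈ Finset.univ.erase x, Q₀ t x y * (Real.exp (f y - f x) - 1)

lemma integrableOn_expDrift (hQ₀ : IsGenerator T Q₀) (f : S → ℝ) (x : S)
    {s t : ℝ} (hs : 0 ≤ s) (ht : t < T) :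
    IntegrableOn (fun u => expDrift Q₀ f u x) (Set.Icc s t) := by
  unfold expDrift
  exact integrable_finsetSum _ fun y _ => (hQ₀.integrableOn_Icc hs ht x y).mul_const _

/-- The running cost `E ∫ ∑_{y ≠ X_t} (Q log (Q / Q⁰) - Q + Q⁰)(X_t, y) dt`. -/
noncomputable def runningCost (T : ℝ) (Q₀ : ℝ → S → S → ℝ) (t₀ : ℝ) (Q : ℝ → S → S → ℝ) (P : Measure Ω)
    (X : ℝ → Ω → S) : ENNReal :=
  ∫⁻ ω, (∫⁻ t in Set.Ico t₀ T, costRate Q Q₀ t (X t ω)) ∂P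

lemma IsCTMC.controlCost_eq (hX : IsCTMC T Q t₀ x₀ P X) (h : t₀ ≤ T) (r : S → ℝ) :
    controlCost T Q₀ r t₀ Q P X
      = ((runningCost T Q₀ t₀ Q P X : ENNReal) : EReal) - ((mean P X r T : ℝ) : EReal) := by
  rw [← hX.integral_comp r ⟨h, le_rfl⟩]
  rfl

lemma IsCTMC.runningCost_eq (hX : IsCTMC T Q t₀ x₀ P X) (hQ : IsGenerator T Q)
    (hQ₀ : IsGenerator T Q₀) (h0 : 0 ≤ t₀) :
    runningCost T Q₀ t₀ Q P X
      = ∫⁻ t in Set.Ico t₀ T, ∑ x, P {ω | X t ω = x} * costRate Q Q₀ t x :=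
  hX.lintegral_path _ fun x => aemeasurable_costRate hQ hQ₀ x h0

/-- The mean of `dualRate`. -/
noncomputable def meanDual (P : Measure Ω) (X : ℝ → Ω → S) (Q Q₀ : ℝ → S → S → ℝ) (f : S → ℝ) (u : ℝ) : ℝ :=
  ∑ x, P.real {ω | X u ω = x} * dualRate Q Q₀ f u x

lemma IsCTMC.integrableOn_meanDual (hX : IsCTMC T Q t₀ x₀ P X) (hQ : IsGenerator T Q)
    (hQ₀ : IsGenerator T Q₀) (h0 : 0 ≤ t₀) (f : S → ℝ) {t : ℝ} (ht : t < T) :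
    IntegrableOn (meanDual P X Q Q₀ f) (Set.Icc t₀ t) := by
  unfold meanDual
  exact integrable_finsetSum _ fun x _ => hX.integrableOn_real_mul x le_rfl ht
    (integrableOn_dualRate hQ hQ₀ f x h0 ht)

/-- By definition the dual rate is the generator applied to f minus the exponential drift; Dynkin's
formula integrates the first part. -/
lemma IsCTMC.integral_meanDual (hX : IsCTMC T Q t₀ x₀ P X) (hQ : IsGenerator T Q)
    (hQ₀ : IsGenerator T Q₀) (h0 : 0 ≤ t₀) (f : S → ℝ) {t : ℝ} (ht : t ∈ Set.Ico t₀ T) :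
    ∫ u in t₀..t, meanDual P X Q Q₀ f u = mean P X f t - f x₀
      - ∫ u in t₀..t, ∑ x, P.real {ω | X u ω = x} * expDrift Q₀ f u x := by
  have hP := hX.prob
  have hd := hX.dynkin hQ h0 f le_rfl ht.1 ht.2
  rw [hX.mean_start] at hd
  rw [hd, ← intervalIntegral.integral_sub]
  · refine intervalIntegral.integral_congr fun u hu => ?_
    rw [Set.uIcc_of_le ht.1] at hu
    have hu' : u ∈ Set.Ico 0 T := ⟨h0.trans hu.1, hu.2.trans_lt ht.2⟩
    simp only [meanDual, ← Finset.sum_sub_distrib, ← mul_sub]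
    refine Finset.sum_congr rfl fun x _ => ?_
    rw [hQ.sum_mul f hu' x, dualRate, expDrift, ← Finset.sum_sub_distrib]
  · rw [intervalIntegrable_iff_integrableOn_Icc_of_le ht.1]
    refine integrable_finsetSum _ fun x _ => hX.integrableOn_real_mul x le_rfl ht.2 ?_
    exact integrable_finsetSum _ fun y _ => (hQ.integrableOn_Icc h0 ht.2 x y).mul_const _
  · rw [intervalIntegrable_iff_integrableOn_Icc_of_le ht.1]
    exact integrable_finsetSum _ fun x _ => hX.integrableOn_real_mul x le_rfl ht.2
      (integrableOn_expDrift hQ₀ f x h0 ht.2)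

/-- Since g may change sign, it is compared with its positive part. -/
lemma ofReal_integral_le_lintegral {α : Type*} [MeasurableSpace α] {μ : Measure α} {g : α → ℝ}
    (hg : Integrable g μ) : ENNReal.ofReal (∫ a, g a ∂μ) ≤ ∫⁻ a, ENNReal.ofReal (g a) ∂μ := by
  have h1 : ∫ a, g a ∂μ ≤ ∫ a, max (g a) 0 ∂μ :=
    integral_mono hg hg.pos_part fun a => le_max_left _ _
  refine (ENNReal.ofReal_le_ofReal h1).trans ?_
  rw [ofReal_integral_eq_lintegral_ofReal hg.pos_part (Eventually.of_forall fun a =>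
    le_max_right _ _)]
  refine lintegral_mono fun a => ?_
  rcases le_total (g a) 0 with h | h <;> simp [h]

lemma IsCTMC.ofReal_meanDual_le (hX : IsCTMC T Q t₀ x₀ P X) (hQ : IsGenerator T Q)
    (hQ₀ : IsGenerator T Q₀) (f : S → ℝ) {u : ℝ} (hu : u ∈ Set.Ico 0 T) :
    ENNReal.ofReal (meanDual P X Q Q₀ f u) ≤ ∑ x, P {ω | X u ω = x} * costRate Q Q₀ u x := by
  have hP := hX.prob
  refine (ofReal_sum_le _ _).trans (Finset.sum_le_sum fun x _ => ?_)
  rw [ENNReal.ofReal_mul measureReal_nonneg, ofReal_measureReal]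
  exact mul_le_mul_right (ofReal_dualRate_le_costRate hQ hQ₀ f hu x) _

/-- The verification inequality for the test function `f`. -/
lemma IsCTMC.le_runningCost (hX : IsCTMC T Q t₀ x₀ P X) (hQ : IsGenerator T Q)
    (hQ₀ : IsGenerator T Q₀) (h0 : 0 ≤ t₀) (f : S → ℝ) {t : ℝ} (ht : t ∈ Set.Ico t₀ T) :
    ENNReal.ofReal (mean P X f t - f x₀
      - ∫ u in t₀..t, ∑ x, P.real {ω | X u ω = x} * expDrift Q₀ f u x)
      ≤ runningCost T Q₀ t₀ Q P X := by
  rw [← hX.integral_meanDual hQ hQ₀ h0 f ht, intervalIntegral.integral_of_le ht.1,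
    ← integral_Icc_eq_integral_Ioc, hX.runningCost_eq hQ hQ₀ h0]
  refine (ofReal_integral_le_lintegral (hX.integrableOn_meanDual hQ hQ₀ h0 f ht.2)).trans ?_
  have hsub : Set.Icc t₀ t ⊆ Set.Ico t₀ T := fun u hu => ⟨hu.1, hu.2.trans_lt ht.2⟩
  refine le_trans ?_ (lintegral_mono_set hsub)
  refine setLIntegral_mono' measurableSet_Icc fun u hu => ?_
  exact hX.ofReal_meanDual_le hQ hQ₀ f ⟨h0.trans hu.1, hu.2.trans_lt ht.2⟩

/-- The exhaustion by compact intervals on which the rates are integrable; monotone convergence then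
reaches T. -/
lemma Ico_eq_iUnion_Icc {a b : ℝ} (h : a < b) : ∃ u : ℕ → ℝ, (∀ n, u n ∈ Set.Ico a b) ∧
    Monotone u ∧ Set.Ico a b = ⋃ n, Set.Icc a (u n) := by
  obtain ⟨u, hu, hu1, hu2⟩ := exists_seq_strictMono_tendsto' h
  refine ⟨u, fun n => ⟨(hu1 n).1.le, (hu1 n).2⟩, hu.monotone, ?_⟩
  ext t
  simp only [Set.mem_iUnion]
  constructor
  · intro ht
    obtain ⟨n, hn⟩ := (hu2.eventually (lt_mem_nhds ht.2)).exists
    exact ⟨n, ht.1, hn.le⟩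
  · rintro ⟨n, hn⟩
    exact ⟨hn.1, hn.2.trans_lt (hu1 n).2⟩

/-- The running cost of the generator that is tilted by a harmonic function `exp f`. -/
lemma IsCTMC.runningCost_of_tilted (hX : IsCTMC T Q t₀ x₀ P X) (hQ : IsGenerator T Q)
    (hQ₀ : IsGenerator T Q₀) (h0 : 0 ≤ t₀) (hT : t₀ < T) (f : S → ℝ)
    (hf : ∀ t ∈ Set.Ico 0 T, ∀ x, expDrift Q₀ f t x = 0)
    (htilt : ∀ t ∈ Set.Ico 0 T, ∀ x y, y ≠ x → Q t x y = Q₀ t x y * Real.exp (f y - f x)) :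
    runningCost T Q₀ t₀ Q P X = ENNReal.ofReal (mean P X f T - f x₀) ∧
      0 ≤ mean P X f T - f x₀ := by
  have hP := hX.prob
  -- For tilted rates each summand equals the divergence, which is nonnegative by Fenchel–Young at l
  -- = 0. Termwise nonnegativity lets `ENNReal.ofReal` pass through the sums.
  have hterm : ∀ u ∈ Set.Ico 0 T, ∀ x y, y ≠ x →
      0 ≤ (f y - f x) * Q u x y - Q₀ u x y * (Real.exp (f y - f x) - 1) := by
    intro u hu x y hy
    have hn := hQ₀.nonneg u hu x y hy.symm
    have h1 := fenchel_young_rate (l := 0) (hQ.nonneg u hu x y hy.symm) hn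
      (by intro h; simp [htilt u hu x y hy, h])
    rcases hn.eq_or_lt with h | h
    · simp [htilt u hu x y hy, ← h]
    · have h3 : Q u x y * Real.log (Q u x y / Q₀ u x y) = (f y - f x) * Q u x y := by
        rw [htilt u hu x y hy, mul_div_right_comm, div_self h.ne', one_mul, Real.log_exp]
        ring
      rw [h3] at h1
      have h4 := htilt u hu x y hy
      simp only [zero_mul, Real.exp_zero, sub_self, mul_zero] at h1
      nlinarith
  have hdual : ∀ u ∈ Set.Ico 0 T, ∀ x, 0 ≤ dualRate Q Q₀ f u x := fun u hu x =>
    Finset.sum_nonneg fun y hy => hterm u hu x y (Finset.ne_of_mem_erase hy)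
  have hmd : ∀ u ∈ Set.Ico 0 T, 0 ≤ meanDual P X Q Q₀ f u := fun u hu =>
    Finset.sum_nonneg fun x _ => mul_nonneg measureReal_nonneg (hdual u hu x)
  have hcost : ∀ u ∈ Set.Ico 0 T, ∑ x, P {ω | X u ω = x} * costRate Q Q₀ u x
      = ENNReal.ofReal (meanDual P X Q Q₀ f u) := by
    intro u hu
    rw [meanDual, ENNReal.ofReal_sum_of_nonneg fun x _ =>
      mul_nonneg measureReal_nonneg (hdual u hu x)]
    refine Finset.sum_congr rfl fun x _ => ?_
    rw [ENNReal.ofReal_mul measureReal_nonneg, ofReal_measureReal]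
    congr 1
    rw [costRate, dualRate, ENNReal.ofReal_sum_of_nonneg fun y hy =>
      hterm u hu x y (Finset.ne_of_mem_erase hy)]
    refine Finset.sum_congr rfl fun y hy => ?_
    have hy' := Finset.ne_of_mem_erase hy
    rw [htilt u hu x y hy', rateDivergence_mul_exp (hQ₀.nonneg u hu x y hy'.symm)]
  have hmean : ∀ t ∈ Set.Ico t₀ T, ∫ u in t₀..t, meanDual P X Q Q₀ f u = mean P X f t - f x₀ := by
    intro t ht
    rw [hX.integral_meanDual hQ hQ₀ h0 f ht, sub_eq_self]
    refine intervalIntegral.integral_zero_ae (Eventually.of_forall fun u hu => ?_)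
    rw [Set.uIoc_of_le ht.1] at hu
    simp [hf u ⟨h0.trans hu.1.le, hu.2.trans_lt ht.2⟩]
  -- The increment of the mean is the integral of a nonnegative function, so its limit at T
  -- dominates all earlier values.
  have hmono : ∀ s ∈ Set.Ico t₀ T, ∀ t ∈ Set.Ico t₀ T, s ≤ t →
      mean P X f s - f x₀ ≤ mean P X f t - f x₀ := by
    intro s hs t ht hst
    rw [← hmean s hs, ← hmean t ht]
    refine intervalIntegral.integral_mono_interval le_rfl hs.1 hst ?_ ?_
    · filter_upwards [ae_restrict_mem measurableSet_Ioc] with u hu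
      exact hmd u ⟨h0.trans hu.1.le, hu.2.trans_lt ht.2⟩
    · rw [intervalIntegrable_iff_integrableOn_Icc_of_le ht.1]
      exact hX.integrableOn_meanDual hQ hQ₀ h0 f ht.2
  have hle : ∀ s ∈ Set.Ico t₀ T, mean P X f s - f x₀ ≤ mean P X f T - f x₀ := by
    intro s hs
    refine ge_of_tendsto ((hX.tendsto_mean hT f).sub_const _) ?_
    filter_upwards [Ioo_mem_nhdsLT hs.2] with t ht
    exact hmono s hs t ⟨hs.1.trans ht.1.le, ht.2⟩ ht.1.le
  have hnn : 0 ≤ mean P X f T - f x₀ := by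
    have := hle t₀ ⟨le_rfl, hT⟩
    rwa [hX.mean_start, sub_self] at this
  -- The upper bound comes from the exhaustion by compact intervals, the lower bound from the
  -- verification inequality as t → T.
  refine ⟨le_antisymm ?_ ?_, hnn⟩
  · obtain ⟨u, hu, hum, hU⟩ := Ico_eq_iUnion_Icc hT
    rw [hX.runningCost_eq hQ hQ₀ h0, hU, setLIntegral_iUnion_of_directed]
    · refine iSup_le fun n => ?_
      have hc : ∫⁻ t in Set.Icc t₀ (u n), ∑ x, P {ω | X t ω = x} * costRate Q Q₀ t x
          = ∫⁻ t in Set.Icc t₀ (u n), ENNReal.ofReal (meanDual P X Q Q₀ f t) :=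
        setLIntegral_congr_fun measurableSet_Icc fun t ht =>
          hcost t ⟨h0.trans ht.1, ht.2.trans_lt (hu n).2⟩
      rw [hc, ← ofReal_integral_eq_lintegral_ofReal
        (hX.integrableOn_meanDual hQ hQ₀ h0 f (hu n).2), integral_Icc_eq_integral_Ioc,
        ← intervalIntegral.integral_of_le (hu n).1, hmean _ (hu n)]
      · exact ENNReal.ofReal_le_ofReal (hle _ (hu n))
      · filter_upwards [ae_restrict_mem measurableSet_Icc] with t ht
        exact hmd t ⟨h0.trans ht.1, ht.2.trans_lt (hu n).2⟩
    · exact (monotone_nat_of_le_succ fun n =>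
        Set.Icc_subset_Icc_right (hum n.le_succ)).directed_le
  · refine le_of_tendsto (ENNReal.tendsto_ofReal ((hX.tendsto_mean hT f).sub_const _)) ?_
    filter_upwards [Ioo_mem_nhdsLT hT] with t ht
    have ht' : t ∈ Set.Ico t₀ T := ⟨ht.1.le, ht.2⟩
    have := hX.le_runningCost hQ hQ₀ h0 f ht'
    rwa [← hX.integral_meanDual hQ hQ₀ h0 f ht', hmean t ht'] at this

/-- Equality in the verification inequality forces the tilted rates in all occupied states. -/
lemma IsCTMC.ae_eq_tilted (hX : IsCTMC T Q t₀ x₀ P X) (hQ : IsGenerator T Q)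
    (hQ₀ : IsGenerator T Q₀) (h0 : 0 ≤ t₀) (hT : t₀ < T) (f : S → ℝ)
    (hf : ∀ t ∈ Set.Ico 0 T, ∀ x, expDrift Q₀ f t x = 0)
    (hfin : runningCost T Q₀ t₀ Q P X ≠ ⊤)
    (hle : (runningCost T Q₀ t₀ Q P X).toReal ≤ mean P X f T - f x₀) :
    ∀ᵐ t ∂(volume.restrict (Set.Ico t₀ T)), ∀ x, 0 < P.real {ω | X t ω = x} →
      ∀ y, y ≠ x → Q t x y = Q₀ t x y * Real.exp (f y - f x) := by
  have hP := hX.prob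
  set A : ℝ → ENNReal := fun t => ∑ x, P {ω | X t ω = x} * costRate Q Q₀ t x with hA
  set g := meanDual P X Q Q₀ f with hg
  rw [hX.runningCost_eq hQ hQ₀ h0] at hfin hle
  have hAm : AEMeasurable A (volume.restrict (Set.Ico t₀ T)) :=
    Finset.aemeasurable_fun_sum _ fun x _ =>
      (hX.aemeasurable_measure x).mul (aemeasurable_costRate hQ hQ₀ x h0)
  have hAtop : ∀ᵐ t ∂(volume.restrict (Set.Ico t₀ T)), A t < ⊤ := ae_lt_top' hAm hfin
  have hAi : IntegrableOn (fun t => (A t).toReal) (Set.Ico t₀ T) :=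
    integrable_toReal_of_lintegral_ne_top hAm hfin
  have hAint : ∫ t in Set.Ico t₀ T, (A t).toReal ≤ mean P X f T - f x₀ := by
    rwa [integral_toReal hAm hAtop]
  have hgA : ∀ᵐ t ∂(volume.restrict (Set.Ico t₀ T)), g t ≤ (A t).toReal := by
    filter_upwards [hAtop, ae_restrict_mem measurableSet_Ico] with t h1 h2
    exact (ENNReal.ofReal_le_iff_le_toReal h1.ne).1
      (hX.ofReal_meanDual_le hQ hQ₀ f ⟨h0.trans h2.1, h2.2⟩)
  have hmean : ∀ t ∈ Set.Ico t₀ T, ∫ u in Set.Icc t₀ t, g u = mean P X f t - f x₀ := by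
    intro t ht
    rw [integral_Icc_eq_integral_Ioc, ← intervalIntegral.integral_of_le ht.1,
      hX.integral_meanDual hQ hQ₀ h0 f ht, sub_eq_self]
    refine intervalIntegral.integral_zero_ae (Eventually.of_forall fun u hu => ?_)
    rw [Set.uIoc_of_le ht.1] at hu
    simp [hf u ⟨h0.trans hu.1.le, hu.2.trans_lt ht.2⟩]
  have hsub : ∀ t ∈ Set.Ico t₀ T, Set.Icc t₀ t ⊆ Set.Ico t₀ T :=
    fun t ht u hu => ⟨hu.1, hu.2.trans_lt ht.2⟩
  have hgap : ∀ t ∈ Set.Ico t₀ T, IntegrableOn (fun u => (A u).toReal - g u) (Set.Icc t₀ t) :=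
    fun t ht => (hAi.mono_set (hsub t ht)).sub (hX.integrableOn_meanDual hQ hQ₀ h0 f ht.2)
  have hgap0 : ∀ t ∈ Set.Ico t₀ T,
      0 ≤ᵐ[volume.restrict (Set.Icc t₀ t)] fun u => (A u).toReal - g u := by
    intro t ht
    filter_upwards [ae_restrict_of_ae_restrict_of_subset (hsub t ht) hgA] with u hu
    exact sub_nonneg.2 hu
  -- The accumulated gap up to t is at most what the mean of f still has to gain between t and T.
  have hgaple : ∀ t ∈ Set.Ico t₀ T, ∫ u in Set.Icc t₀ t, ((A u).toReal - g u)
      ≤ mean P X f T - mean P X f t := by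
    intro t ht
    rw [integral_sub (hAi.mono_set (hsub t ht)) (hX.integrableOn_meanDual hQ hQ₀ h0 f ht.2),
      hmean t ht]
    have : ∫ u in Set.Icc t₀ t, (A u).toReal ≤ ∫ u in Set.Ico t₀ T, (A u).toReal :=
      setIntegral_mono_set hAi (Eventually.of_forall fun _ => ENNReal.toReal_nonneg)
        (hsub t ht).eventuallyLE
    linarith
  have hzero : ∀ t ∈ Set.Ico t₀ T, ∀ᵐ u ∂(volume.restrict (Set.Icc t₀ t)),
      (A u).toReal - g u = 0 := by
    intro t ht
    have h1 : ∫ u in Set.Icc t₀ t, ((A u).toReal - g u) ≤ 0 := by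
      have hlim : Tendsto (fun s => mean P X f T - mean P X f s) (𝓝[<] T)
          (𝓝 (mean P X f T - mean P X f T)) := tendsto_const_nhds.sub (hX.tendsto_mean hT f)
      rw [sub_self] at hlim
      refine ge_of_tendsto hlim ?_
      -- The gap on [t₀, t] is at most the gap on [t₀, s] for every later s, and that bound tends to
      -- zero as s → T.
      filter_upwards [Ioo_mem_nhdsLT ht.2] with s hs
      have hs' : s ∈ Set.Ico t₀ T := ⟨ht.1.trans hs.1.le, hs.2⟩
      refine le_trans ?_ (hgaple s hs')
      exact setIntegral_mono_set (hgap s hs') (hgap0 s hs')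
        (Set.Icc_subset_Icc_right hs.1.le).eventuallyLE
    exact (integral_eq_zero_iff_of_nonneg_ae (hgap0 t ht) (hgap t ht)).1
      (le_antisymm h1 (integral_nonneg_of_ae (hgap0 t ht)))
  obtain ⟨u, hu, -, hU⟩ := Ico_eq_iUnion_Icc hT
  have hall : ∀ᵐ t ∂(volume.restrict (Set.Ico t₀ T)), (A t).toReal - g t = 0 := by
    rw [hU, ae_restrict_iUnion_iff]
    exact fun n => hzero _ (hu n)
  filter_upwards [hall, hAtop, ae_restrict_mem measurableSet_Ico] with t h1 h2 h3 x hx y hy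
  have ht : t ∈ Set.Ico 0 T := ⟨h0.trans h3.1, h3.2⟩
  have hterm : ∀ x ∈ Finset.univ, P {ω | X t ω = x} * costRate Q Q₀ t x ≠ ⊤ := by
    simpa [hA, ENNReal.sum_eq_top, lt_top_iff_ne_top] using h2
  have hsum : (A t).toReal = ∑ x, P.real {ω | X t ω = x} * (costRate Q Q₀ t x).toReal := by
    rw [hA]
    simp only [Measure.real, ← ENNReal.toReal_mul]
    exact ENNReal.toReal_sum hterm
  -- The cost rate may be infinite in a state of probability zero, where 0 * ⊤ = 0; in an occupied
  -- state it is finite.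
  have hctop : ∀ x, 0 < P.real {ω | X t ω = x} → costRate Q Q₀ t x ≠ ⊤ := by
    intro x hx h
    refine hterm x (Finset.mem_univ x) ?_
    rw [h, ENNReal.mul_top]
    intro h0
    simp [Measure.real, h0] at hx
  have hpt : ∀ x ∈ Finset.univ, P.real {ω | X t ω = x} * dualRate Q Q₀ f t x
      ≤ P.real {ω | X t ω = x} * (costRate Q Q₀ t x).toReal := by
    intro x _
    rcases (measureReal_nonneg (μ := P) (s := {ω | X t ω = x})).eq_or_lt with h | h
    · simp [← h]
    · refine mul_le_mul_of_nonneg_left ?_ h.le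
      exact (ENNReal.ofReal_le_iff_le_toReal (hctop x h)).1
        (ofReal_dualRate_le_costRate hQ hQ₀ f ht x)
  have heq := (Finset.sum_eq_sum_iff_of_le hpt).1 (by
    rw [← hsum, eq_comm, ← sub_eq_zero]
    exact h1) x (Finset.mem_univ x)
  exact eq_of_costRate_eq_dualRate hQ hQ₀ f ht x (hctop x hx)
    (mul_left_cancel₀ hx.ne' heq).ge hy

end Chains

/-! ### Matrices with zero row sums -/

section RateMatrix

variable {S : Type} [Fintype S] [DecidableEq S]

lemma rateMatrix_of_ne (R : S → S → ℝ) {x y : S} (h : y ≠ x) : rateMatrix R x y = R x y := by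
  simp [rateMatrix, h]

lemma rateMatrix_sum (R : S → S → ℝ) (x : S) : ∑ y, rateMatrix R x y = 0 := by
  rw [← Finset.add_sum_erase _ _ (Finset.mem_univ x),
    Finset.sum_congr rfl fun y hy => rateMatrix_of_ne R (Finset.ne_of_mem_erase hy)]
  simp [rateMatrix]

lemma rateMatrix_congr {R R' : S → S → ℝ} {x : S} (h : ∀ y, y ≠ x → R x y = R' x y) (y : S) :
    rateMatrix R x y = rateMatrix R' x y := by
  unfold rateMatrix
  rw [Finset.sum_congr rfl fun y hy => h y (Finset.ne_of_mem_erase hy)]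
  split_ifs with hy
  · rfl
  · exact h y hy

lemma tiltedGenerator_of_ne (Q₀ : ℝ → S → S → ℝ) (V : ℝ → S → ℝ) (t : ℝ) {x y : S} (h : y ≠ x) :
    tiltedGenerator Q₀ V t x y = Q₀ t x y * Real.exp (V t y - V t x) :=
  rateMatrix_of_ne _ h

/-- The entries of a matrix with zero row sums are determined off the diagonal. -/
lemma eq_of_offDiag_eq {A B : S → S → ℝ} {x : S} (hA : ∑ y, A x y = 0) (hB : ∑ y, B x y = 0)
    (h : ∀ y, y ≠ x → A x y = B x y) (y : S) : A x y = B x y := by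
  by_cases hy : y = x
  · subst hy
    rw [← Finset.add_sum_erase _ _ (Finset.mem_univ y)] at hA hB
    rw [Finset.sum_congr rfl fun z hz => h z (Finset.ne_of_mem_erase hz)] at hA
    linarith
  · exact h y hy

end RateMatrix

/-! ### Masked sequences and the jumps of the reference generator -/

section Masked

variable {D N : ℕ}

/-- The positions of the mask token. -/
def masked (x : State D N) : Finset (Fin D) := Finset.univ.filter fun d => x d = none

@[simp]
lemma mem_masked {x : State D N} {d : Fin D} : d ∈ masked x ↔ x d = none := by simp [masked]

lemma setToken_same (x : State D N) (d : Fin D) (n : Fin N) : setToken x d n d = some n := by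
  simp [setToken]

lemma setToken_of_ne (x : State D N) {d e : Fin D} (n : Fin N) (h : e ≠ d) :
    setToken x d n e = x e := by
  simp [setToken, h]

lemma setToken_ne {x : State D N} {d : Fin D} (hd : x d = none) (n : Fin N) :
    setToken x d n ≠ x := by
  intro h
  have := setToken_same x d n
  rw [h, hd] at this
  cases this

lemma masked_setToken (x : State D N) (d : Fin D) (n : Fin N) :
    masked (setToken x d n) = (masked x).erase d := by
  ext e
  by_cases h : e = d
  · subst h
    simp [setToken_same]
  · simp [setToken_of_ne x n h, h]

lemma card_masked_setToken {x : State D N} {d : Fin D} (hd : x d = none) (n : Fin N) :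
    (masked (setToken x d n)).card + 1 = (masked x).card := by
  rw [masked_setToken, Finset.card_erase_add_one (by simpa using hd)]

lemma setToken_injective {x : State D N} {d e : Fin D} {n k : Fin N} (hd : x d = none)
    (h : setToken x d n = setToken x e k) : d = e ∧ n = k := by
  have hde : d = e := by
    by_contra hne
    have h1 := congrFun h d
    rw [setToken_same, setToken_of_ne x k hne, hd] at h1
    cases h1
  subst hde
  have h1 := congrFun h d
  rw [setToken_same, setToken_same] at h1
  exact ⟨rfl, Option.some_injective _ h1⟩

lemma maskGenerator_setToken (γ : ℝ → ℝ) (t : ℝ) {x : State D N} {d : Fin D} (hd : x d = none)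
    (n : Fin N) : maskGenerator D N γ t x (setToken x d n) = γ t / N := by
  rw [maskGenerator, rateMatrix_of_ne _ (setToken_ne hd n), if_pos ⟨d, n, hd, rfl⟩]

lemma maskGenerator_eq_zero (γ : ℝ → ℝ) (t : ℝ) {x y : State D N} (hy : y ≠ x)
    (h : ∀ d n, x d = none → y ≠ setToken x d n) : maskGenerator D N γ t x y = 0 := by
  rw [maskGenerator, rateMatrix_of_ne _ hy, if_neg]
  rintro ⟨d, n, h1, h2⟩
  exact h d n h1 h2

/-- Distinct pairs of a masked position and a token give distinct neighbours, so the sum over the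
states can be reindexed. -/
lemma sum_erase_eq_sum_setToken {F : State D N → ℝ} {x : State D N}
    (hF : ∀ y, y ≠ x → (∀ d n, x d = none → y ≠ setToken x d n) → F y = 0) :
    ∑ y ∈ Finset.univ.erase x, F y = ∑ d ∈ masked x, ∑ n, F (setToken x d n) := by
  classical
  rw [← Finset.sum_product']
  have hinj : Set.InjOn (fun p : Fin D × Fin N => setToken x p.1 p.2)
      (masked x ×ˢ (Finset.univ : Finset (Fin N)) : Finset _) := by
    rintro ⟨d, n⟩ h1 ⟨e, k⟩ - h
    simp only [Finset.coe_product, Set.mem_prod, Finset.mem_coe, mem_masked] at h1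
    obtain ⟨rfl, rfl⟩ := setToken_injective h1.1 h
    rfl
  rw [← Finset.sum_image (f := F) hinj]
  symm
  refine Finset.sum_subset ?_ ?_
  · intro y hy
    obtain ⟨⟨d, n⟩, h1, rfl⟩ := Finset.mem_image.1 hy
    simp only [Finset.mem_product, mem_masked] at h1
    simpa using setToken_ne h1.1 n
  · intro y hy h
    refine hF y (Finset.ne_of_mem_erase hy) fun d n hd hyd => h ?_
    exact Finset.mem_image.2 ⟨(d, n), by simpa using hd, hyd.symm⟩

lemma sum_maskGenerator_mul (γ : ℝ → ℝ) (t : ℝ) (x : State D N) (g : State D N → ℝ) :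
    ∑ y ∈ Finset.univ.erase x, maskGenerator D N γ t x y * g y
      = γ t / N * ∑ d ∈ masked x, ∑ n, g (setToken x d n) := by
  rw [sum_erase_eq_sum_setToken fun y hy h => by rw [maskGenerator_eq_zero γ t hy h, zero_mul],
    Finset.mul_sum]
  refine Finset.sum_congr rfl fun d hd => ?_
  rw [Finset.mul_sum]
  refine Finset.sum_congr rfl fun n _ => ?_
  rw [maskGenerator_setToken γ t (mem_masked.1 hd)]

/-- The reference dynamics is a homogeneous chain run along the clock ∫ γ; the matrix with unit rate
is frozen at the irrelevant time 0. -/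
lemma maskGenerator_eq_mul (γ : ℝ → ℝ) (t : ℝ) (x y : State D N) :
    maskGenerator D N γ t x y = γ t * maskGenerator D N (fun _ => 1) 0 x y := by
  by_cases h : y = x
  · subst h
    simp only [maskGenerator, rateMatrix, if_true]
    rw [mul_neg, Finset.mul_sum]
    congr 1
    refine Finset.sum_congr rfl fun z _ => ?_
    split_ifs <;> ring
  · simp only [maskGenerator, rateMatrix, if_neg h]
    split_ifs <;> ring

/-- The tilted generator for a time-independent tilt is the noise schedule times a matrix. -/
lemma tiltedGenerator_eq_mul (γ : ℝ → ℝ) (V : State D N → ℝ) (t : ℝ) (x y : State D N) :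
    tiltedGenerator (maskGenerator D N γ) (fun _ => V) t x y
      = γ t * tiltedGenerator (maskGenerator D N fun _ => 1) (fun _ => V) 0 x y := by
  unfold tiltedGenerator
  simp only [maskGenerator_eq_mul γ t]
  unfold rateMatrix
  split_ifs
  · rw [mul_neg, Finset.mul_sum]
    congr 1
    exact Finset.sum_congr rfl fun z _ => by ring
  · ring

lemma maskGenerator_nonneg {γ : ℝ → ℝ} {t : ℝ} (hγ : 0 ≤ γ t) {x y : State D N} (h : x ≠ y) :
    0 ≤ maskGenerator D N γ t x y := by
  rw [maskGenerator, rateMatrix_of_ne _ h.symm]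
  split_ifs
  · positivity
  · rfl

lemma isGenerator_maskGenerator {T : ℝ} {γ : ℝ → ℝ} (hγ : ∀ t ∈ Set.Ico 0 T, 0 ≤ γ t)
    (hγ_loc : LocallyIntegrableOn γ (Set.Ico 0 T) volume) :
    IsGenerator T (maskGenerator D N γ) where
  nonneg t ht x y h := maskGenerator_nonneg (hγ t ht) h
  row_sum t _ x := rateMatrix_sum _ x
  locallyIntegrable x y := by
    simp only [maskGenerator_eq_mul γ _ x y]
    exact fun t ht => let ⟨s, hs, h⟩ := hγ_loc t ht; ⟨s, hs, h.mul_const _⟩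

lemma isGenerator_tiltedGenerator {T : ℝ} {γ : ℝ → ℝ} (hγ : ∀ t ∈ Set.Ico 0 T, 0 ≤ γ t)
    (hγ_loc : LocallyIntegrableOn γ (Set.Ico 0 T) volume) (V : State D N → ℝ) :
    IsGenerator T (tiltedGenerator (maskGenerator D N γ) fun _ => V) where
  nonneg t ht x y h := by
    rw [tiltedGenerator_of_ne _ _ _ h.symm]
    exact mul_nonneg (maskGenerator_nonneg (hγ t ht) h) (Real.exp_pos _).le
  row_sum t _ x := rateMatrix_sum _ x
  locallyIntegrable x y := by
    simp only [tiltedGenerator_eq_mul γ V _ x y]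
    exact fun t ht => let ⟨s, hs, h⟩ := hγ_loc t ht; ⟨s, hs, h.mul_const _⟩

/-! ### The value function -/

/-- The total weight of the unmasked sequences that agree with `x`. -/
noncomputable def agreeSum (w : (Fin D → Fin N) → ℝ) (x : State D N) : ℝ := ∑ z, (agrees x).indicator w z

lemma agrees_setToken {x : State D N} {d : Fin D} (hd : x d = none) (n : Fin N) :
    agrees (setToken x d n) = agrees x ∩ {z | z d = n} := by
  ext z
  simp only [agrees, Set.mem_ofPred_eq, Set.mem_inter_iff]
  constructor
  · intro h
    refine ⟨fun e he => ?_, ?_⟩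
    · have hed : e ≠ d := fun h => he (h ▸ hd)
      have := h e
      rw [setToken_of_ne x n hed] at this
      exact this he
    · have := h d
      rw [setToken_same] at this
      exact (Option.some_injective _ (this (by simp))).symm
  · rintro ⟨h1, rfl⟩ e he
    by_cases hed : e = d
    · subst hed
      exact setToken_same _ _ _
    · rw [setToken_of_ne x _ hed] at he ⊢
      exact h1 e he

/-- The completions of x are partitioned by their token at the masked position d. This identity is
the source of all harmonicity below. -/
lemma sum_agreeSum_setToken (w : (Fin D → Fin N) → ℝ) {x : State D N} {d : Fin D}
    (hd : x d = none) : ∑ n, agreeSum w (setToken x d n) = agreeSum w x := by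
  classical
  unfold agreeSum
  rw [Finset.sum_comm]
  refine Finset.sum_congr rfl fun z _ => ?_
  simp only [agrees_setToken hd, Set.indicator_apply, Set.mem_inter_iff, Set.mem_ofPred_eq]
  by_cases hz : z ∈ agrees x <;> simp [hz]

lemma agrees_nonempty (hN : 0 < N) (x : State D N) : ∃ z, z ∈ agrees x := by
  refine ⟨fun d => (x d).getD ⟨0, hN⟩, fun d hd => ?_⟩
  obtain ⟨n, hn⟩ := Option.ne_none_iff_exists'.1 hd
  simp [hn]

lemma agreeSum_pos (hN : 0 < N) {w : (Fin D → Fin N) → ℝ} (hw : ∀ z, 0 < w z) (x : State D N) :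
    0 < agreeSum w x := by
  obtain ⟨z, hz⟩ := agrees_nonempty hN x
  refine Finset.sum_pos' (fun z _ => Set.indicator_nonneg (fun z _ => (hw z).le) z)
    ⟨z, Finset.mem_univ z, ?_⟩
  rw [Set.indicator_of_mem hz]
  exact hw z

lemma agrees_embed (z : Fin D → Fin N) : agrees (embed z) = {z} := by
  ext z'
  simp only [agrees, embed, Set.mem_ofPred_eq, Set.mem_singleton_iff]
  constructor
  · intro h
    exact funext fun d => (Option.some_injective _ (h d (by simp))).symm
  · rintro rfl d _
    rfl

lemma agreeSum_embed (w : (Fin D → Fin N) → ℝ) (z : Fin D → Fin N) :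
    agreeSum w (embed z) = w z := by
  classical
  simp [agreeSum, agrees_embed, Set.indicator_apply]

lemma masked_embed (z : Fin D → Fin N) : masked (embed z) = ∅ := by
  ext d
  simp [embed]

lemma exists_embed_of_masked_eq_empty {x : State D N} (h : masked x = ∅) : ∃ z, x = embed z := by
  have h1 : ∀ d, ∃ n, x d = some n := by
    intro d
    refine Option.ne_none_iff_exists'.1 fun hd => ?_
    have : d ∈ masked x := by simpa using hd
    simp [h] at this
  choose z hz using h1
  exact ⟨z, funext hz⟩

/-- The mean weight of a uniformly random completion of `x`. -/
noncomputable def completionMean (w : (Fin D → Fin N) → ℝ) (x : State D N) : ℝ :=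
  agreeSum w x / (N : ℝ) ^ (masked x).card

/-- One mask fewer in the exponent is paid for by the factor N, which brings all neighbours of x to
the denominator of x. -/
lemma completionMean_setToken (hN : 0 < N) (w : (Fin D → Fin N) → ℝ) {x : State D N} {d : Fin D}
    (hd : x d = none) (n : Fin N) : completionMean w (setToken x d n)
      = N * agreeSum w (setToken x d n) / (N : ℝ) ^ (masked x).card := by
  have hN' : (N : ℝ) ≠ 0 := by positivity
  rw [completionMean, ← card_masked_setToken hd n, pow_succ]
  field_simp

/-- The mean weight of completions is harmonic for the masking dynamics. -/
lemma sum_completionMean_setToken (hN : 0 < N) (w : (Fin D → Fin N) → ℝ) {x : State D N}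
    {d : Fin D} (hd : x d = none) :
    ∑ n, (completionMean w (setToken x d n) - completionMean w x) = 0 := by
  rw [Finset.sum_sub_distrib]
  simp only [completionMean_setToken hN w hd]
  rw [← Finset.sum_div, ← Finset.mul_sum, sum_agreeSum_setToken w hd]
  simp only [completionMean, Finset.sum_const, Finset.card_univ, Fintype.card_fin, nsmul_eq_mul]
  ring

/-- The time-independent value function `log E[exp (r (X_T)) | X_t = x]` of the problem. -/
noncomputable def potential (U : (Fin D → Fin N) → ℝ) (x : State D N) : ℝ :=
  Real.log (completionMean (fun z => Real.exp (-U z)) x) + D * Real.log N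

lemma completionMean_pos (hN : 0 < N) (U : (Fin D → Fin N) → ℝ) (x : State D N) :
    0 < completionMean (fun z => Real.exp (-U z)) x := by
  have := agreeSum_pos hN (fun z => Real.exp_pos (-U z)) x
  unfold completionMean
  positivity

lemma exp_potential_sub (hN : 0 < N) (U : (Fin D → Fin N) → ℝ) (x y : State D N) :
    Real.exp (potential U y - potential U x)
      = completionMean (fun z => Real.exp (-U z)) y
        / completionMean (fun z => Real.exp (-U z)) x := by
  have hx := completionMean_pos hN U x
  have hy := completionMean_pos hN U y
  rw [potential, potential, add_sub_add_right_eq_sub, Real.exp_sub, Real.exp_log hx,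
    Real.exp_log hy]

lemma exp_potential_setToken (hN : 0 < N) (U : (Fin D → Fin N) → ℝ) {x : State D N} {d : Fin D}
    (hd : x d = none) (n : Fin N) :
    Real.exp (potential U (setToken x d n) - potential U x)
      = N * (agreeSum (fun z => Real.exp (-U z)) (setToken x d n)
        / agreeSum (fun z => Real.exp (-U z)) x) := by
  have hx := agreeSum_pos hN (fun z => Real.exp_pos (-U z)) x
  have hN' : (N : ℝ) ≠ 0 := by positivity
  rw [exp_potential_sub hN, completionMean_setToken hN _ hd, completionMean]
  field_simp

/-- The additive constant D log N in the potential is chosen to match the uniform reference weight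
in the reward; it cancels in every tilt. -/
lemma potential_embed (U : (Fin D → Fin N) → ℝ) (z : Fin D → Fin N) :
    potential U (embed z) = -U z - Real.log (1 / (N : ℝ) ^ D) := by
  rw [potential, completionMean, agreeSum_embed, masked_embed]
  simp

/-- Divided by its value at x, the completion mean is exp (f y - f x), so its harmonicity at each
masked position makes the drift vanish. -/
lemma expDrift_potential (hN : 0 < N) (γ : ℝ → ℝ) (U : (Fin D → Fin N) → ℝ) (t : ℝ)
    (x : State D N) : expDrift (maskGenerator D N γ) (potential U) t x = 0 := by
  rw [expDrift, sum_maskGenerator_mul γ t x fun y => Real.exp (potential U y - potential U x) - 1]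
  rw [Finset.sum_eq_zero, mul_zero]
  intro d hd
  have hx := completionMean_pos hN U x
  have h := sum_completionMean_setToken hN (fun z => Real.exp (-U z)) (mem_masked.1 hd)
  have h2 : ∀ n, Real.exp (potential U (setToken x d n) - potential U x) - 1
      = (completionMean (fun z => Real.exp (-U z)) (setToken x d n)
        - completionMean (fun z => Real.exp (-U z)) x)
        / completionMean (fun z => Real.exp (-U z)) x := by
    intro n
    rw [exp_potential_sub hN]
    field_simp
  simp only [h2]
  rw [← Finset.sum_div, h, zero_div]

/-- The optimal generator, in terms of the total weights of completions. -/
lemma tiltedGenerator_setToken (hN : 0 < N) (γ : ℝ → ℝ) (U : (Fin D → Fin N) → ℝ) (t : ℝ)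
    {x : State D N} {d : Fin D} (hd : x d = none) (n : Fin N) :
    tiltedGenerator (maskGenerator D N γ) (fun _ => potential U) t x (setToken x d n)
      = γ t * (agreeSum (fun z => Real.exp (-U z)) (setToken x d n)
        / agreeSum (fun z => Real.exp (-U z)) x) := by
  have hN' : (N : ℝ) ≠ 0 := by positivity
  rw [tiltedGenerator_of_ne _ _ _ (setToken_ne hd n), maskGenerator_setToken γ t hd,
    exp_potential_setToken hN U hd]
  field_simp

lemma tiltedGenerator_eq_zero (γ : ℝ → ℝ) (V : ℝ → State D N → ℝ) (t : ℝ) {x y : State D N}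
    (hy : y ≠ x) (h : ∀ d n, x d = none → y ≠ setToken x d n) :
    tiltedGenerator (maskGenerator D N γ) V t x y = 0 := by
  rw [tiltedGenerator_of_ne _ _ _ hy, maskGenerator_eq_zero γ t hy h, zero_mul]

/-- At each masked position the conditional token probabilities sum to one. The tilt thus changes
which token is revealed but not the exit rate, which is why exponential times independent of the
tokens can realize it. -/
lemma tiltedGenerator_diag (hN : 0 < N) (γ : ℝ → ℝ) (U : (Fin D → Fin N) → ℝ) (t : ℝ)
    (x : State D N) :
    tiltedGenerator (maskGenerator D N γ) (fun _ => potential U) t x x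
      = -((masked x).card * γ t) := by
  have h := rateMatrix_sum (fun x y => maskGenerator D N γ t x y
    * Real.exp (potential U y - potential U x)) x
  rw [← Finset.add_sum_erase _ _ (Finset.mem_univ x)] at h
  change tiltedGenerator (maskGenerator D N γ) (fun _ => potential U) t x x
    + ∑ y ∈ Finset.univ.erase x,
      tiltedGenerator (maskGenerator D N γ) (fun _ => potential U) t x y = 0 at h
  rw [sum_erase_eq_sum_setToken fun y hy h => tiltedGenerator_eq_zero γ _ t hy h] at h
  have h2 : ∀ d ∈ masked x, ∑ n, tiltedGenerator (maskGenerator D N γ) (fun _ => potential U) t x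
      (setToken x d n) = γ t := by
    intro d hd
    have hx := agreeSum_pos hN (fun z => Real.exp_pos (-U z)) x
    simp only [tiltedGenerator_setToken hN γ U t (mem_masked.1 hd)]
    rw [← Finset.mul_sum, ← Finset.sum_div, sum_agreeSum_setToken _ (mem_masked.1 hd),
      div_self hx.ne', mul_one]
  rw [Finset.sum_congr rfl h2, Finset.sum_const, nsmul_eq_mul] at h
  linarith

/-- The reference generator is the tilted generator of the constant energy. -/
lemma tiltedGenerator_potential_zero (hN : 0 < N) (γ : ℝ → ℝ) :
    tiltedGenerator (maskGenerator D N γ) (fun _ => potential fun _ => 0)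
      = maskGenerator D N γ := by
  -- A sequence with k masks has N ^ k completions, by induction on k through the partition
  -- identity.
  have hc : ∀ x : State D N, agreeSum (fun _ => (1 : ℝ)) x = (N : ℝ) ^ (masked x).card := by
    suffices ∀ k, ∀ x : State D N, (masked x).card = k →
        agreeSum (fun _ => (1 : ℝ)) x = (N : ℝ) ^ k from fun x => this _ x rfl
    intro k
    induction k with
    | zero =>
      intro x hx
      obtain ⟨z, rfl⟩ := exists_embed_of_masked_eq_empty (Finset.card_eq_zero.1 hx)
      simp [agreeSum_embed]
    | succ k ih =>
      intro x hx
      obtain ⟨d, hd⟩ : (masked x).Nonempty := by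
        rw [← Finset.card_pos]
        omega
      have hd' := mem_masked.1 hd
      rw [← sum_agreeSum_setToken _ hd']
      have : ∀ n, agreeSum (fun _ => (1 : ℝ)) (setToken x d n) = (N : ℝ) ^ k := fun n =>
        ih _ (by have := card_masked_setToken hd' n; omega)
      simp only [this, Finset.sum_const, Finset.card_univ, Fintype.card_fin, nsmul_eq_mul]
      ring
  have hN' : (N : ℝ) ≠ 0 := by positivity
  have hV : ∀ x : State D N, potential (fun _ => 0) x = D * Real.log N := by
    intro x
    simp [potential, completionMean, hc, hN']
  funext t x y
  unfold tiltedGenerator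
  simp only [hV, sub_self, Real.exp_zero, mul_one]
  exact rateMatrix_congr (fun y hy => rateMatrix_of_ne _ hy) y

/-! ### The target distribution -/

lemma target_real (U : (Fin D → Fin N) → ℝ) (s : Set (Fin D → Fin N)) :
    (target U).real s = (∑ z, s.indicator (fun z => Real.exp (-U z)) z)
      / ∑ w, Real.exp (-U w) := by
  classical
  have hs : MeasurableSet s := (Set.toFinite s).measurableSet
  have hZ : 0 ≤ ∑ w, Real.exp (-U w) := Finset.sum_nonneg fun w _ => (Real.exp_pos _).le
  rw [Measure.real, target, Measure.finsetSum_apply, ENNReal.toReal_sum, Finset.sum_div]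
  · refine Finset.sum_congr rfl fun z _ => ?_
    rw [Measure.smul_apply, Measure.dirac_apply' _ hs, smul_eq_mul, ENNReal.toReal_mul,
      ENNReal.toReal_ofReal (div_nonneg (Real.exp_pos _).le hZ)]
    by_cases hz : z ∈ s <;> simp [hz]
  · intro z _
    rw [Measure.smul_apply, Measure.dirac_apply' _ hs, smul_eq_mul]
    refine ENNReal.mul_ne_top ENNReal.ofReal_ne_top ?_
    by_cases hz : z ∈ s <;> simp [hz]

instance (U : (Fin D → Fin N) → ℝ) : IsFiniteMeasure (target U) := by
  unfold target
  refine ⟨?_⟩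
  rw [Measure.finsetSum_apply]
  refine ENNReal.sum_lt_top.2 fun z _ => ?_
  simp

lemma sum_exp_pos (hN : 0 < N) (U : (Fin D → Fin N) → ℝ) : 0 < ∑ w, Real.exp (-U w) :=
  Finset.sum_pos (fun _ _ => Real.exp_pos _) ⟨fun _ => ⟨0, hN⟩, Finset.mem_univ _⟩

/-- The normalizing constant cancels, leaving ratios of unnormalized completion weights. -/
lemma cond_target_real (hN : 0 < N) (U : (Fin D → Fin N) → ℝ) (x : State D N)
    (s : Set (Fin D → Fin N)) :
    ((target U)[|agrees x]).real s
      = (∑ z, (agrees x ∩ s).indicator (fun z => Real.exp (-U z)) z)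
        / agreeSum (fun z => Real.exp (-U z)) x := by
  have hZ := sum_exp_pos hN U
  have hx := agreeSum_pos hN (fun z => Real.exp_pos (-U z)) x
  rw [Measure.real, cond_apply (Set.toFinite _).measurableSet, ENNReal.toReal_mul,
    ENNReal.toReal_inv]
  change ((target U).real _)⁻¹ * (target U).real _ = _
  rw [target_real, target_real]
  change (agreeSum (fun z => Real.exp (-U z)) x / _)⁻¹ * _ = _
  field_simp

lemma isProbabilityMeasure_cond_target (hN : 0 < N) (U : (Fin D → Fin N) → ℝ) (x : State D N) :
    IsProbabilityMeasure ((target U)[|agrees x]) := by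
  refine cond_isProbabilityMeasure fun h => ?_
  have h1 : (target U).real (agrees x) = 0 := by rw [Measure.real, h, ENNReal.toReal_zero]
  have hx := agreeSum_pos hN (fun z => Real.exp_pos (-U z)) x
  rw [target_real] at h1
  exact (div_pos hx (sum_exp_pos hN U)).ne' h1

lemma condMarginal_eq (hN : 0 < N) (U : (Fin D → Fin N) → ℝ) {x : State D N} {d : Fin D}
    (hd : x d = none) (n : Fin N) :
    condMarginal U x d n = agreeSum (fun z => Real.exp (-U z)) (setToken x d n)
      / agreeSum (fun z => Real.exp (-U z)) x := by
  rw [condMarginal, cond_target_real hN, ← agrees_setToken hd]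
  rfl

/-- The rates of the optimal generator. -/
lemma tiltedGenerator_formula (hN : 0 < N) (γ : ℝ → ℝ) (U : (Fin D → Fin N) → ℝ) (t : ℝ)
    (x : State D N) (d : Fin D) (n : Fin N) (h : setToken x d n ≠ x) :
    tiltedGenerator (maskGenerator D N γ) (fun _ => potential U) t x (setToken x d n)
      = γ t * condMarginal U x d n * (if x d = none then 1 else 0) := by
  split_ifs with hd
  · rw [tiltedGenerator_setToken hN γ U t hd, condMarginal_eq hN U hd, mul_one]
  · rw [mul_zero]
    -- Overwriting a revealed token is not a jump: a genuine jump would reveal some position e,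
    -- which is masked in x and therefore differs from d.
    refine tiltedGenerator_eq_zero γ _ t h fun e k he heq => ?_
    by_cases hed : d = e
    · exact hd (hed ▸ he)
    · have h1 := congrFun heq e
      rw [setToken_of_ne x n (Ne.symm hed), setToken_same, he] at h1
      cases h1

end Masked

/-! ### Calculus along an absolutely continuous clock -/

section AbsolutelyContinuous

lemma AbsolutelyContinuousOnInterval.lipschitz_comp {G F : ℝ → ℝ} {a b : ℝ} {K : NNReal}
    {s : Set ℝ} (hF : LipschitzOnWith K F s) (hG : AbsolutelyContinuousOnInterval G a b)
    (hs : Set.MapsTo G (Set.uIcc a b) s) :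
    AbsolutelyContinuousOnInterval (fun u => F (G u)) a b := by
  rw [absolutelyContinuousOnInterval_iff] at hG ⊢
  intro ε hε
  have hK : (0 : ℝ) < K + 1 := by positivity
  obtain ⟨δ, hδ, h⟩ := hG (ε / (K + 1)) (by positivity)
  refine ⟨δ, hδ, fun E hE hlt => ?_⟩
  have h1 := h E hE hlt
  rw [lt_div_iff₀ hK] at h1
  refine lt_of_le_of_lt ?_ h1
  rw [Finset.sum_mul]
  refine Finset.sum_le_sum fun i hi => ?_
  have hmem := hE.1 i hi
  refine (hF.dist_le_mul _ (hs hmem.1) _ (hs hmem.2)).trans ?_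
  nlinarith [dist_nonneg (x := G (E.2 i).1) (y := G (E.2 i).2)]

/-- G has bounded range on the interval, and a C¹ function is Lipschitz there. -/
lemma AbsolutelyContinuousOnInterval.comp_of_hasDerivAt {G F F' : ℝ → ℝ} {a b : ℝ}
    (hF : ∀ x, HasDerivAt F (F' x) x) (hF' : Continuous F')
    (hG : AbsolutelyContinuousOnInterval G a b) :
    AbsolutelyContinuousOnInterval (fun u => F (G u)) a b := by
  obtain ⟨M, hM⟩ := hG.exists_bound
  obtain ⟨C, hC⟩ := (isCompact_Icc (a := -M) (b := M)).exists_bound_of_continuousOn hF'.continuousOn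
  have hlip : LipschitzOnWith C.toNNReal F (Set.Icc (-M) M) := by
    refine (convex_Icc _ _).lipschitzOnWith_of_nnnorm_hasDerivWithin_le
      (fun x _ => (hF x).hasDerivWithinAt) fun x hx => ?_
    rw [← NNReal.coe_le_coe, coe_nnnorm]
    exact (hC x hx).trans (Real.le_coe_toNNReal C)
  exact AbsolutelyContinuousOnInterval.lipschitz_comp hlip hG fun u hu => abs_le.1 (hM u hu)

/-- The chain rule for the primitive of an integrable function, in integrated form. -/
lemma integral_deriv_comp_primitive {γ F F' : ℝ → ℝ} (hF : ∀ x, HasDerivAt F (F' x) x)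
    (hF' : Continuous F') {a s t : ℝ} (hs : a ≤ s) (hst : s ≤ t)
    (hγ : IntervalIntegrable γ volume a t) :
    ∫ u in s..t, F' (∫ v in a..u, γ v) * γ u
      = F (∫ v in a..t, γ v) - F (∫ v in a..s, γ v) := by
  have hac : AbsolutelyContinuousOnInterval (fun u => ∫ v in a..u, γ v) a t :=
    hγ.absolutelyContinuousOnInterval_intervalIntegral (by simp)
  have hsub : Set.uIcc s t ⊆ Set.uIcc a t := by
    rw [Set.uIcc_of_le hst, Set.uIcc_of_le (hs.trans hst)]
    exact Set.Icc_subset_Icc_left hs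
  -- Since γ is merely integrable, its primitive is differentiable only almost everywhere; absolute
  -- continuity of the composition still gives the fundamental theorem of calculus.
  have hFac := AbsolutelyContinuousOnInterval.comp_of_hasDerivAt hF hF' (hac.mono hsub)
  rw [← hFac.integral_deriv_eq_sub]
  refine intervalIntegral.integral_congr_ae ?_
  filter_upwards [hγ.ae_hasDerivAt_integral] with u hu hmem
  have h1 := hu (hsub (Set.uIoc_subset_uIcc hmem)) a (by simp)
  exact ((hF _).comp u h1).deriv.symm

/-- Solving a scalar linear equation by an integrating factor. -/
lemma mul_exp_eq_of_linear {γ p f g : ℝ → ℝ} {a b : ℝ} (k : ℝ) (hab : a ≤ b)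
    (hγ : IntervalIntegrable γ volume a b) (hf : IntervalIntegrable f volume a b)
    (hp : ∀ t ∈ Set.Icc a b, p t = p a + ∫ u in a..t, f u)
    (hfg : ∀ t ∈ Set.Icc a b, f t = g t - k * γ t * p t) :
    p b * Real.exp (k * ∫ v in a..b, γ v)
      = p a + ∫ u in a..b, g u * Real.exp (k * ∫ v in a..u, γ v) := by
  have hGac : AbsolutelyContinuousOnInterval (fun u => ∫ v in a..u, γ v) a b :=
    hγ.absolutelyContinuousOnInterval_intervalIntegral (by simp)
  have hE : ∀ x, HasDerivAt (fun v => Real.exp (k * v)) (Real.exp (k * x) * (k * 1)) x := fun x =>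
    ((hasDerivAt_id x).const_mul k).exp
  have hEac := AbsolutelyContinuousOnInterval.comp_of_hasDerivAt hE (by fun_prop) hGac
  have hfac : AbsolutelyContinuousOnInterval (fun u => ∫ v in a..u, f v) a b :=
    hf.absolutelyContinuousOnInterval_intervalIntegral (by simp)
  have hid : ∀ x : ℝ, HasDerivAt (fun v => p a + v) 1 x := fun x => (hasDerivAt_id x).const_add _
  -- The explicit primitive replaces p, about which nothing is known outside [a, b].
  have hPac := AbsolutelyContinuousOnInterval.comp_of_hasDerivAt hid continuous_const hfac
  have key := hPac.integral_deriv_mul_eq_sub hEac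
  simp only [intervalIntegral.integral_same, mul_zero, Real.exp_zero, add_zero, mul_one] at key
  rw [← hp b ⟨hab, le_rfl⟩] at key
  rw [← sub_eq_iff_eq_add', ← key]
  refine intervalIntegral.integral_congr_ae ?_
  filter_upwards [hγ.ae_hasDerivAt_integral, hf.ae_hasDerivAt_integral] with u h1 h2 hmem
  have hu : u ∈ Set.uIcc a b := Set.uIoc_subset_uIcc hmem
  have h1' := h1 hu a (by simp)
  have h2' := h2 hu a (by simp)
  have hu' : u ∈ Set.Icc a b := by rwa [Set.uIcc_of_le hab] at hu
  have e1 : deriv (fun u => Real.exp (k * ∫ v in a..u, γ v)) u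
      = Real.exp (k * ∫ v in a..u, γ v) * (k * 1) * γ u := ((hE _).comp u h1').deriv
  have e2 : deriv (fun u => p a + ∫ v in a..u, f v) u = f u := (h2'.const_add _).deriv
  rw [e1, e2, ← hp u hu', hfg u hu']
  ring

end AbsolutelyContinuous

/-! ### Explicit transition weights of the optimal chain -/

section TransitionWeights

variable {D N : ℕ}

/-- `x` arises from `y` by unmasking. -/
def Extends (y x : State D N) : Prop := ∀ d, y d ≠ none → x d = y d

lemma Extends.masked_subset {y x : State D N} (h : Extends y x) : masked x ⊆ masked y := by
  intro d hd
  rw [mem_masked] at hd ⊢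
  by_contra hy
  exact hy (by rw [← h d hy, hd])

lemma Extends.setToken {y x : State D N} (h : Extends y x) {d : Fin D} (hd : x d = none)
    (n : Fin N) : Extends y (setToken x d n) := by
  intro e he
  have : e ≠ d := by
    rintro rfl
    exact he (by rw [← h e he, hd])
  rw [setToken_of_ne x n this, h e he]

lemma Extends.agrees_subset {y x : State D N} (h : Extends y x) : agrees x ⊆ agrees y := by
  intro z hz d hd
  rw [← h d hd]
  exact hz d (by rwa [h d hd])

/-- The sequence with the `d`-th entry masked. -/
def remask (y : State D N) (d : Fin D) : State D N := Function.update y d none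

lemma remask_same (y : State D N) (d : Fin D) : remask y d d = none := by simp [remask]

lemma remask_of_ne (y : State D N) {d e : Fin D} (h : e ≠ d) : remask y d e = y e := by
  simp [remask, h]

lemma remask_setToken {x : State D N} {d : Fin D} (hd : x d = none) (n : Fin N) :
    remask (setToken x d n) d = x := by
  funext e
  by_cases h : e = d
  · subst h
    rw [remask_same, hd]
  · rw [remask_of_ne _ h, setToken_of_ne x n h]

lemma setToken_remask {y : State D N} {d : Fin D} {n : Fin N} (hd : y d = some n) :
    setToken (remask y d) d n = y := by
  funext e
  by_cases h : e = d
  · subst h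
    rw [setToken_same, hd]
  · rw [setToken_of_ne _ n h, remask_of_ne _ h]

open Classical in
/-- The unnormalized probability that the optimal chain, in state `y` when the clock shows
`-log a`, is in state `x` when the clock shows `v`. -/
noncomputable def transWeight (w : (Fin D → Fin N) → ℝ) (a : ℝ) (y : State D N) (v : ℝ)
    (x : State D N) : ℝ :=
  if Extends y x then
    (a - Real.exp (-v)) ^ ((masked y).card - (masked x).card)
      * Real.exp (-v) ^ (masked x).card * agreeSum w x
  else 0

/-- The completion weight of the predecessor cancels against the denominator of its jump rate. The
result does not depend on d, so the inflow into x is a multiple of a single term. -/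
lemma transWeight_remask (hN : 0 < N) (U : (Fin D → Fin N) → ℝ) (a v : ℝ) {y x : State D N}
    (hyx : Extends y x) {d : Fin D} (hdy : y d = none) (hdx : x d ≠ none) :
    transWeight (fun z => Real.exp (-U z)) a y v (remask x d)
      * tiltedGenerator (maskGenerator D N fun _ => 1) (fun _ => potential U) 0 (remask x d) x
    = (a - Real.exp (-v)) ^ ((masked y).card - (masked x).card - 1)
      * Real.exp (-v) ^ ((masked x).card + 1) * agreeSum (fun z => Real.exp (-U z)) x := by
  obtain ⟨n, hn⟩ := Option.ne_none_iff_exists'.1 hdx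
  have h1 : Extends y (remask x d) := by
    intro e he
    have : e ≠ d := by
      rintro rfl
      exact he hdy
    rw [remask_of_ne _ this, hyx e he]
  have hx := setToken_remask hn
  have hW := agreeSum_pos hN (fun z => Real.exp_pos (-U z)) (remask x d)
  have hc := card_masked_setToken (remask_same x d) n
  rw [hx] at hc
  have hq := tiltedGenerator_setToken hN (fun _ => 1) U 0 (remask_same x d) n
  rw [hx] at hq
  rw [hq, transWeight, if_pos h1, ← hc, Nat.sub_sub]
  field_simp

/-- The transition weights solve the Kolmogorov forward equation with respect to the clock. -/
lemma hasDerivAt_transWeight (hN : 0 < N) (U : (Fin D → Fin N) → ℝ) (a : ℝ) (y x : State D N)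
    (v : ℝ) : HasDerivAt (fun v => transWeight (fun z => Real.exp (-U z)) a y v x)
      (∑ x', transWeight (fun z => Real.exp (-U z)) a y v x'
        * tiltedGenerator (maskGenerator D N fun _ => 1) (fun _ => potential U) 0 x' x) v := by
  classical
  set w := fun z => Real.exp (-U z) with hw
  set q := tiltedGenerator (maskGenerator D N fun _ => 1) (fun _ => potential U) 0 with hq
  by_cases hyx : Extends y x
  -- Only the predecessors of x that still extend y carry weight: those that remask a position
  -- revealed between y and x.
  · have hsum : ∑ x' ∈ Finset.univ.erase x, transWeight w a y v x' * q x' x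
        = ∑ d ∈ masked y \ masked x, transWeight w a y v (remask x d) * q (remask x d) x := by
      have hinj : Set.InjOn (remask x) (masked y \ masked x : Finset (Fin D)) := by
        intro d hd e he h
        by_contra hne
        have h1 := congrFun h d
        rw [remask_same, remask_of_ne _ hne] at h1
        simp only [Finset.coe_sdiff, Set.mem_sdiff, Finset.mem_coe, mem_masked] at hd
        exact hd.2 h1.symm
      rw [← Finset.sum_image (f := fun x' => transWeight w a y v x' * q x' x) hinj]
      symm
      refine Finset.sum_subset ?_ ?_
      · intro x' hx'
        obtain ⟨d, hd, rfl⟩ := Finset.mem_image.1 hx'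
        simp only [Finset.mem_sdiff, mem_masked] at hd
        refine Finset.mem_erase.2 ⟨fun h => hd.2 ?_, Finset.mem_univ _⟩
        rw [← congrFun h d, remask_same]
      · intro x' hx' hni
        by_cases hex : ∃ d n, x' d = none ∧ x = setToken x' d n
        · obtain ⟨d, n, hd, rfl⟩ := hex
          rw [transWeight, if_neg, zero_mul]
          intro hyx'
          refine hni (Finset.mem_image.2 ⟨d, ?_, remask_setToken hd n⟩)
          have hd' : d ∈ masked y := hyx'.masked_subset (by simpa using hd)
          simp [setToken_same, mem_masked.1 hd']
        · rw [hq, tiltedGenerator_eq_zero _ _ _ (Finset.ne_of_mem_erase hx').symm, mul_zero]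
          exact fun d n h1 h2 => hex ⟨d, n, h1, h2⟩
    rw [← Finset.add_sum_erase _ _ (Finset.mem_univ x), hsum,
      Finset.sum_congr rfl fun d hd => by
        simp only [Finset.mem_sdiff, mem_masked] at hd
        exact transWeight_remask hN U a v hyx hd.1 hd.2,
      Finset.sum_const, nsmul_eq_mul, hq, tiltedGenerator_diag hN,
      Finset.card_sdiff_of_subset hyx.masked_subset]
    simp only [transWeight, if_pos hyx]
    set i := (masked y).card - (masked x).card
    set j := (masked x).card
    have he : HasDerivAt (fun v => Real.exp (-v)) (-Real.exp (-v)) v := by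
      simpa using (hasDerivAt_id v).neg.exp
    have h1 := ((he.const_sub a).pow i).mul (he.pow j)
    refine (h1.mul_const (agreeSum w x)).congr_deriv ?_
    simp only [Pi.pow_apply, ← hw]
    -- The power rule produces the truncated exponent j - 1, so j = 0 is treated apart.
    rcases Nat.eq_zero_or_pos j with hj | hj
    · simp [hj]
      ring
    · obtain ⟨j', hj'⟩ : ∃ j', j = j' + 1 := ⟨j - 1, by omega⟩
      simp only [hj', Nat.add_sub_cancel, pow_succ _ j']
      push_cast
      ring
  · have h0 : ∀ v, transWeight w a y v x = 0 := fun v => if_neg hyx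
    simp only [h0]
    have : ∑ x', transWeight w a y v x' * q x' x = 0 := by
      refine Finset.sum_eq_zero fun x' _ => ?_
      by_cases hx' : x' = x
      · rw [hx', h0, zero_mul]
      by_cases hex : ∃ d n, x' d = none ∧ x = setToken x' d n
      · obtain ⟨d, n, hd, rfl⟩ := hex
        rw [transWeight, if_neg, zero_mul]
        exact fun h => hyx (h.setToken hd n)
      · rw [hq, tiltedGenerator_eq_zero _ _ _ (Ne.symm hx'), mul_zero]
        exact fun d n h1 h2 => hex ⟨d, n, h1, h2⟩
    rw [this]
    exact hasDerivAt_const _ _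

lemma continuous_transWeight (w : (Fin D → Fin N) → ℝ) (a : ℝ) (y x : State D N) :
    Continuous fun v => transWeight w a y v x := by
  unfold transWeight
  split_ifs
  · fun_prop
  · exact continuous_const

end TransitionWeights

/-! ### Exponential waiting times and independence of coordinates -/

section Exponential

lemma expMeasure_real_Iic {v : ℝ} (hv : 0 ≤ v) :
    (expMeasure 1).real (Set.Iic v) = 1 - Real.exp (-v) := by
  have := isProbabilityMeasure_expMeasure one_pos
  rw [← cdf_eq_real, cdf_expMeasure_eq one_pos, if_pos hv, one_mul]

lemma expMeasure_real_Ioi {v : ℝ} (hv : 0 ≤ v) :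
    (expMeasure 1).real (Set.Ioi v) = Real.exp (-v) := by
  have := isProbabilityMeasure_expMeasure one_pos
  rw [← Set.compl_Iic, probReal_compl_eq_one_sub measurableSet_Iic, expMeasure_real_Iic hv]
  ring

lemma expMeasure_real_Ioc {a v : ℝ} (ha : 0 ≤ a) (hv : a ≤ v) :
    (expMeasure 1).real (Set.Ioc a v) = Real.exp (-a) - Real.exp (-v) := by
  have := isProbabilityMeasure_expMeasure one_pos
  have h : Set.Ioc a v = Set.Iic v \ Set.Iic a := by
    ext e
    simp [and_comm]
  rw [h, measureReal_sdiff (Set.Iic_subset_Iic.2 hv) measurableSet_Iic,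
    expMeasure_real_Iic ha, expMeasure_real_Iic (ha.trans hv)]
  ring

end Exponential

/-- Coordinates in M are independent of those outside M, and a box condition on M factorizes
further. -/
lemma pi_inter_box {ι : Type*} [Fintype ι] [DecidableEq ι] (μ : ι → Measure ℝ)
    [∀ i, IsProbabilityMeasure (μ i)] (M : Finset ι) {B : Set ((i : (Mᶜ : Finset ι)) → ℝ)}
    (hB : MeasurableSet B) {I : ι → Set ℝ} (hI : ∀ i, MeasurableSet (I i)) :
    (Measure.pi μ) ({e | (fun i : (Mᶜ : Finset ι) => e i) ∈ B} ∩ {e | ∀ d ∈ M, e d ∈ I d})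
      = (Measure.pi μ) {e | (fun i : (Mᶜ : Finset ι) => e i) ∈ B} * ∏ d ∈ M, μ d (I d) := by
  have hind : iIndepFun (fun (i : ι) (e : ι → ℝ) => e i) (Measure.pi μ) :=
    iIndepFun_pi (X := fun _ x => x) fun _ => aemeasurable_id
  have h1 := hind.indepFun_finset Mᶜ M disjoint_compl_left fun i => measurable_pi_apply i
  have hbox : MeasurableSet {g : M → ℝ | ∀ d : M, g d ∈ I d} := by
    simpa [Set.pi] using MeasurableSet.univ_pi (t := fun d : M => I d) fun d => hI d
  have h2 := h1.measure_inter_preimage_eq_mul B _ hB hbox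
  have h3 : (fun (e : ι → ℝ) (i : M) => e i) ⁻¹' {g : M → ℝ | ∀ d : M, g d ∈ I d}
      = {e | ∀ d ∈ M, e d ∈ I d} := by
    ext e
    simp
  have h4 : {e : ι → ℝ | ∀ d ∈ M, e d ∈ I d}
      = Set.univ.pi fun d => if d ∈ M then I d else Set.univ := by
    ext e
    simp only [Set.mem_ofPred_eq, Set.mem_pi, Set.mem_univ, true_imp_iff]
    refine forall_congr' fun d => ?_
    split_ifs with h <;> simp [h]
  rw [h3] at h2
  refine h2.trans ?_
  congr 1
  rw [h4, Measure.pi_pi, ← Finset.prod_subset (Finset.subset_univ M)]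
  · exact Finset.prod_congr rfl fun d hd => by rw [if_pos hd]
  · intro d _ hd
    rw [if_neg hd, measure_univ]

/-! ### The unmasking chain and its Markov property -/

section UnmaskingChain

variable {D N : ℕ}

/-- The path that reveals the `d`-th token of `ω.2` when the clock `Γ` passes `ω.1 d`. -/
noncomputable def unmaskPath (T : ℝ) (Γ : ℝ → ℝ) (x₀ : State D N) (t : ℝ)
    (ω : (Fin D → ℝ) × (Fin D → Fin N)) : State D N := fun d =>
  open Classical in if x₀ d = none ∧ t < T ∧ Γ t < ω.1 d then none else some (ω.2 d)

/-- Independent exponential waiting times and an independent sample of the target given the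
unmasked entries of `x₀`. -/
noncomputable def unmaskMeasure (U : (Fin D → Fin N) → ℝ) (x₀ : State D N) :
    Measure ((Fin D → ℝ) × (Fin D → Fin N)) :=
  (Measure.pi fun _ => expMeasure 1).prod ((target U)[|agrees x₀])

variable {T : ℝ} {Γ : ℝ → ℝ} {x₀ : State D N} {ω : (Fin D → ℝ) × (Fin D → Fin N)} {t : ℝ}

lemma unmaskPath_eq_none {d : Fin D} :
    unmaskPath T Γ x₀ t ω d = none ↔ x₀ d = none ∧ t < T ∧ Γ t < ω.1 d := by
  classical
  simp [unmaskPath]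

lemma unmaskPath_of_ne_none {d : Fin D} (h : unmaskPath T Γ x₀ t ω d ≠ none) :
    unmaskPath T Γ x₀ t ω d = some (ω.2 d) := by
  rw [Ne, unmaskPath_eq_none] at h
  simp only [unmaskPath, if_neg h]

lemma unmaskPath_eq_iff {x : State D N} (ht : t < T) : unmaskPath T Γ x₀ t ω = x ↔
    (∀ d, x d = none ↔ x₀ d = none ∧ Γ t < ω.1 d) ∧ ω.2 ∈ agrees x := by
  constructor
  · rintro rfl
    refine ⟨fun d => ?_, fun d hd => unmaskPath_of_ne_none hd⟩
    rw [unmaskPath_eq_none]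
    simp [ht]
  · rintro ⟨h1, h2⟩
    funext d
    by_cases hd : x d = none
    · rw [hd, unmaskPath_eq_none]
      exact ⟨((h1 d).1 hd).1, ht, ((h1 d).1 hd).2⟩
    · rw [h2 d hd]
      refine unmaskPath_of_ne_none fun h => hd ((h1 d).2 ?_)
      rw [unmaskPath_eq_none] at h
      exact ⟨h.1, h.2.2⟩

lemma measurableSet_unmaskPath_eq (x : State D N) :
    MeasurableSet {ω | unmaskPath T Γ x₀ t ω = x} := by
  have : {ω | unmaskPath T Γ x₀ t ω = x} = ⋂ d, {ω | unmaskPath T Γ x₀ t ω d = x d} := by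
    ext ω
    simp [funext_iff]
  rw [this]
  refine MeasurableSet.iInter fun d => ?_
  have h1 : MeasurableSet {ω : (Fin D → ℝ) × (Fin D → Fin N) |
      x₀ d = none ∧ t < T ∧ Γ t < ω.1 d} := by
    refine (MeasurableSet.const _).inter ((MeasurableSet.const _).inter ?_)
    exact measurableSet_lt measurable_const ((measurable_pi_apply d).comp measurable_fst)
  cases hx : x d with
  | none =>
    simpa only [unmaskPath_eq_none] using h1
  | some n =>
    have : {ω | unmaskPath T Γ x₀ t ω d = some n}
        = {ω : (Fin D → ℝ) × (Fin D → Fin N) | x₀ d = none ∧ t < T ∧ Γ t < ω.1 d}ᶜ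
          ∩ {ω | ω.2 d = n} := by
      ext ω
      simp only [Set.mem_ofPred_eq, Set.mem_inter_iff, Set.mem_compl_iff, ← unmaskPath_eq_none]
      constructor
      · intro h
        have hne : unmaskPath T Γ x₀ t ω d ≠ none := by simp [h]
        refine ⟨hne, ?_⟩
        rw [unmaskPath_of_ne_none hne] at h
        exact Option.some_injective _ h
      · rintro ⟨h1, h2⟩
        rw [unmaskPath_of_ne_none h1, h2]
    rw [this]
    refine h1.compl.inter ?_
    have hm : Measurable fun ω : (Fin D → ℝ) × (Fin D → Fin N) => ω.2 d :=
      (measurable_pi_apply d).comp measurable_snd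
    exact hm (measurableSet_singleton n)

variable {t₀ s : ℝ}

lemma unmaskPath_masked_mono (hΓ : MonotoneOn Γ (Set.Ico t₀ T)) (h0 : t₀ ≤ t) (hts : t ≤ s)
    (hs : s < T) {d : Fin D} (h : unmaskPath T Γ x₀ s ω d = none) :
    unmaskPath T Γ x₀ t ω d = none := by
  rw [unmaskPath_eq_none] at h ⊢
  exact ⟨h.1, hts.trans_lt hs,
    (hΓ ⟨h0, hts.trans_lt hs⟩ ⟨h0.trans hts, hs⟩ hts).trans_lt h.2.2⟩

lemma extends_unmaskPath (hΓ : MonotoneOn Γ (Set.Ico t₀ T)) (h0 : t₀ ≤ t) (hts : t ≤ s)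
    (hs : s < T) : Extends (unmaskPath T Γ x₀ t ω) (unmaskPath T Γ x₀ s ω) := by
  intro d hd
  rw [unmaskPath_of_ne_none hd, unmaskPath_of_ne_none]
  exact fun h => hd (unmaskPath_masked_mono hΓ h0 hts hs h)

/-- Up to time `s`, the history is determined by the state at time `s` and the waiting times of
the positions that are unmasked at time `s`. -/
lemma mem_iff_of_history (hΓ : MonotoneOn Γ (Set.Ico t₀ T)) (hs : s < T)
    {A : Set ((Fin D → ℝ) × (Fin D → Fin N))}
    (hA : MeasurableSet[history (unmaskPath T Γ x₀) t₀ s] A)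
    {ω ω' : (Fin D → ℝ) × (Fin D → Fin N)}
    (h1 : unmaskPath T Γ x₀ s ω = unmaskPath T Γ x₀ s ω')
    (h2 : ∀ d, unmaskPath T Γ x₀ s ω d ≠ none → ω.1 d = ω'.1 d) : ω ∈ A ↔ ω' ∈ A := by
  induction A, hA using MeasurableSpace.generateFrom_induction with
  | hC A hA _ =>
    obtain ⟨u, hu, x, rfl⟩ := hA
    -- A position masked at time s was masked at all earlier times; for a revealed one, the waiting
    -- time and the token determine its past.
    suffices unmaskPath T Γ x₀ u ω = unmaskPath T Γ x₀ u ω' by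
      simp only [Set.mem_ofPred_eq, this]
    funext d
    by_cases hd : unmaskPath T Γ x₀ s ω d = none
    · rw [unmaskPath_masked_mono hΓ hu.1 hu.2 hs hd,
        unmaskPath_masked_mono hΓ hu.1 hu.2 hs (h1 ▸ hd)]
    · have h3 : ω.2 d = ω'.2 d := by
        have := congrFun h1 d
        rw [unmaskPath_of_ne_none hd, unmaskPath_of_ne_none (h1 ▸ hd)] at this
        exact Option.some_injective _ this
      simp only [unmaskPath, h2 d hd, h3]
  | empty => rfl
  | compl A _ ih => exact not_congr ih
  | iUnion A _ ih =>
    simp only [Set.mem_iUnion]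
    exact exists_congr ih

lemma measurableSet_of_history {A : Set ((Fin D → ℝ) × (Fin D → Fin N))}
    (hA : MeasurableSet[history (unmaskPath T Γ x₀) t₀ s] A) : MeasurableSet A := by
  refine MeasurableSpace.generateFrom_le ?_ A hA
  rintro _ ⟨u, -, x, rfl⟩
  exact measurableSet_unmaskPath_eq x

lemma isProbabilityMeasure_unmaskMeasure (hN : 0 < N) (U : (Fin D → Fin N) → ℝ)
    (x₀ : State D N) : IsProbabilityMeasure (unmaskMeasure U x₀) := by
  have := isProbabilityMeasure_expMeasure one_pos
  have := isProbabilityMeasure_cond_target hN U x₀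
  unfold unmaskMeasure
  infer_instance

lemma ae_agrees_unmaskMeasure (hN : 0 < N) (U : (Fin D → Fin N) → ℝ) (x₀ : State D N) :
    ∀ᵐ ω ∂(unmaskMeasure U x₀), ω.2 ∈ agrees x₀ := by
  have := isProbabilityMeasure_expMeasure one_pos
  have := isProbabilityMeasure_cond_target hN U x₀
  have h : ∀ᵐ z ∂((target U)[|agrees x₀]), z ∈ agrees x₀ :=
    ae_cond_mem (Set.toFinite _).measurableSet
  exact Measure.quasiMeasurePreserving_snd.ae h

lemma ae_pos_unmaskMeasure (hN : 0 < N) (U : (Fin D → Fin N) → ℝ) (x₀ : State D N) :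
    ∀ᵐ ω ∂(unmaskMeasure U x₀), ∀ d, 0 < ω.1 d := by
  have := isProbabilityMeasure_expMeasure one_pos
  have := isProbabilityMeasure_cond_target hN U x₀
  refine ae_all_iff.2 fun d => ?_
  have h : ∀ᵐ e ∂(expMeasure 1), 0 < e := by
    have h0 := expMeasure_real_Iic le_rfl
    rw [neg_zero, Real.exp_zero, sub_self, measureReal_eq_zero_iff] at h0
    filter_upwards [measure_eq_zero_iff_ae_notMem.1 h0] with e he
    simpa using he
  have h2 : ∀ᵐ e ∂(Measure.pi fun _ : Fin D => expMeasure 1), 0 < e d :=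
    (Measure.quasiMeasurePreserving_eval (fun _ : Fin D => expMeasure 1) d).ae h
  exact Measure.quasiMeasurePreserving_fst.ae h2

lemma cond_target_agrees (hN : 0 < N) (U : (Fin D → Fin N) → ℝ) {x : State D N}
    (hx : Extends x₀ x) : ((target U)[|agrees x₀]).real (agrees x)
      = agreeSum (fun z => Real.exp (-U z)) x / agreeSum (fun z => Real.exp (-U z)) x₀ := by
  rw [cond_target_real hN, Set.inter_eq_right.2 hx.agrees_subset]
  rfl

lemma extends_unmaskPath_of_agrees (h : ω.2 ∈ agrees x₀) :
    Extends x₀ (unmaskPath T Γ x₀ t ω) := by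
  intro d hd
  rw [unmaskPath_of_ne_none, h d hd]
  rw [Ne, unmaskPath_eq_none]
  exact fun h => hd h.1

/-- The Markov property of the unmasking chain, with explicit transition weights. -/
lemma exists_transition_const (hN : 0 < N) (U : (Fin D → Fin N) → ℝ)
    (hΓ : MonotoneOn Γ (Set.Ico t₀ T)) (hΓ0 : ∀ t ∈ Set.Ico t₀ T, 0 ≤ Γ t)
    (hs : s ∈ Set.Ico t₀ T) {A : Set ((Fin D → ℝ) × (Fin D → Fin N))}
    (hA : MeasurableSet[history (unmaskPath T Γ x₀) t₀ s] A) (y : State D N) :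
    ∃ C : ℝ, ∀ u ∈ Set.Ico s T, ∀ x, (unmaskMeasure U x₀).real
      (A ∩ {ω | unmaskPath T Γ x₀ s ω = y} ∩ {ω | unmaskPath T Γ x₀ u ω = x})
        = C * transWeight (fun z => Real.exp (-U z)) (Real.exp (-Γ s)) y (Γ u) x := by
  classical
  have hP := isProbabilityMeasure_unmaskMeasure hN U x₀
  by_cases hy : Extends x₀ y
  swap
  -- Almost every path extends its initial state, so other intermediate states have probability
  -- zero.
  · refine ⟨0, fun u _ x => ?_⟩
    rw [zero_mul, measureReal_eq_zero_iff, measure_eq_zero_iff_ae_notMem]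
    filter_upwards [ae_agrees_unmaskMeasure hN U x₀] with ω hω h
    exact hy (h.1.2 ▸ extends_unmaskPath_of_agrees hω)
  obtain ⟨z₀, hz₀⟩ := agrees_nonempty hN y
  have hx₀ : ∀ d, y d = none → x₀ d = none := by
    intro d hd
    by_contra h
    exact h (by rw [← hy d h, hd])
  set M := masked y with hM
  -- The waiting times of still masked positions get the dummy value Γ s + 1; anything beyond Γ s
  -- would do. Likewise z₀ is an arbitrary completion of y.
  set extd : ((i : (Mᶜ : Finset (Fin D))) → ℝ) → Fin D → ℝ :=
    fun g d => if h : d ∈ Mᶜ then g ⟨d, h⟩ else Γ s + 1 with hextd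
  have hextd_meas : Measurable extd := by
    refine measurable_pi_lambda _ fun d => ?_
    by_cases h : d ∈ Mᶜ
    · simp only [hextd, dif_pos h]
      exact measurable_pi_apply _
    · simp only [hextd, dif_neg h]
      exact measurable_const
  set B : Set ((i : (Mᶜ : Finset (Fin D))) → ℝ) :=
    {g | (extd g, z₀) ∈ A ∩ {ω | unmaskPath T Γ x₀ s ω = y}} with hB
  have hBm : MeasurableSet B :=
    (hextd_meas.prodMk measurable_const)
      ((measurableSet_of_history hA).inter (measurableSet_unmaskPath_eq y))
  have hon : ∀ (e : Fin D → ℝ) d, y d ≠ none → extd (fun i => e i) d = e d := by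
    intro e d hd
    have : d ∈ Mᶜ := by simpa [hM] using hd
    simp only [hextd, dif_pos this]
  have hoff : ∀ (e : Fin D → ℝ) d, y d = none → extd (fun i => e i) d = Γ s + 1 := by
    intro e d hd
    have : d ∉ Mᶜ := by simpa [hM] using hd
    simp only [hextd, dif_neg this]
  -- On the event of state y at time s, a past event constrains only the waiting times of the
  -- revealed positions. The other conditions are that the remaining times exceed Γ s and that the
  -- tokens match y, so the event is a product.
  have hkey : ∀ ω : (Fin D → ℝ) × (Fin D → Fin N),
      ω ∈ A ∩ {ω | unmaskPath T Γ x₀ s ω = y} ↔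
        (fun i : (Mᶜ : Finset (Fin D)) => ω.1 i) ∈ B ∧ (∀ d, y d = none → Γ s < ω.1 d)
          ∧ ω.2 ∈ agrees y := by
    intro ω
    have hiff : unmaskPath T Γ x₀ s ω = y →
        unmaskPath T Γ x₀ s (extd (fun i => ω.1 i), z₀) = y →
        (ω ∈ A ↔ (extd (fun i => ω.1 i), z₀) ∈ A) := by
      intro h1 h2
      refine mem_iff_of_history hΓ hs.2 hA (h1.trans h2.symm) fun d hd => ?_
      rw [h1] at hd
      exact (hon _ d hd).symm
    constructor
    · rintro ⟨h1, h2⟩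
      have h3 := (unmaskPath_eq_iff hs.2).1 h2
      have h4 : unmaskPath T Γ x₀ s (extd (fun i => ω.1 i), z₀) = y := by
        rw [unmaskPath_eq_iff hs.2]
        refine ⟨fun d => ?_, hz₀⟩
        by_cases hd : y d = none
        · simp [hd, hx₀ d hd, hoff _ d hd]
        · dsimp only
          rw [h3.1 d, hon _ d hd]
      exact ⟨⟨(hiff h2 h4).1 h1, h4⟩, fun d hd => ((h3.1 d).1 hd).2, h3.2⟩
    · rintro ⟨⟨h1, h2⟩, h3, h4⟩
      have h5 := (unmaskPath_eq_iff hs.2).1 h2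
      have h6 : unmaskPath T Γ x₀ s ω = y := by
        rw [unmaskPath_eq_iff hs.2]
        refine ⟨fun d => ?_, h4⟩
        by_cases hd : y d = none
        · simp [hd, hx₀ d hd, h3 d hd]
        · rw [h5.1 d]
          dsimp only
          rw [hon _ d hd]
      exact ⟨(hiff h6 h2).2 h1, h6⟩
  have hE := isProbabilityMeasure_expMeasure one_pos
  have hμ := isProbabilityMeasure_cond_target hN U x₀
  -- This constant collects everything that does not involve u or x: the past of the revealed
  -- positions and the normalization of the conditioned target.
  refine ⟨(Measure.pi fun _ : Fin D => expMeasure 1).real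
    {e | (fun i : (Mᶜ : Finset (Fin D)) => e i) ∈ B}
      / agreeSum (fun z => Real.exp (-U z)) x₀, fun u hu x => ?_⟩
  have hsu : Γ s ≤ Γ u := hΓ hs ⟨hs.1.trans hu.1, hu.2⟩ hu.1
  by_cases hx : Extends y x
  swap
  · rw [transWeight, if_neg hx, mul_zero]
    convert measureReal_empty
    refine Set.eq_empty_of_forall_notMem fun ω hω => hx ?_
    rw [← hω.1.2, ← hω.2]
    exact extends_unmaskPath hΓ hs.1 hu.1 hu.2
  -- For a position masked in y: either its waiting time exceeds Γ u, or it was passed between s and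
  -- u.
  set I : Fin D → Set ℝ := fun d =>
    if x d = none then Set.Ioi (Γ u) else Set.Ioc (Γ s) (Γ u) with hI
  have hIm : ∀ d, MeasurableSet (I d) := by
    intro d
    simp only [hI]
    split_ifs
    · exact measurableSet_Ioi
    · exact measurableSet_Ioc
  have hset : A ∩ {ω | unmaskPath T Γ x₀ s ω = y} ∩ {ω | unmaskPath T Γ x₀ u ω = x}
      = ({e | (fun i : (Mᶜ : Finset (Fin D)) => e i) ∈ B} ∩ {e | ∀ d ∈ M, e d ∈ I d})
        ×ˢ agrees x := by
    ext ω
    rw [Set.mem_inter_iff, hkey, Set.mem_prod, Set.mem_inter_iff]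
    change (_ ∧ unmaskPath T Γ x₀ u ω = x) ↔ _
    rw [unmaskPath_eq_iff hu.2]
    constructor
    · rintro ⟨⟨h1, h2, h3⟩, h4, h5⟩
      refine ⟨⟨h1, fun d hd => ?_⟩, h5⟩
      rw [hM, mem_masked] at hd
      simp only [hI]
      split_ifs with hxd
      · exact ((h4 d).1 hxd).2
      · refine ⟨h2 d hd, not_lt.1 fun h => hxd ((h4 d).2 ⟨hx₀ d hd, h⟩)⟩
    · rintro ⟨⟨h1, h2⟩, h3⟩
      have h4 : ∀ d, y d = none → Γ s < ω.1 d := by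
        intro d hd
        have := h2 d (by simpa [hM] using hd)
        simp only [hI] at this
        split_ifs at this
        · exact hsu.trans_lt this
        · exact this.1
      have h5 := (hkey ω).2 ⟨h1, h4, hx.agrees_subset h3⟩
      refine ⟨⟨h1, h4, hx.agrees_subset h3⟩, fun d => ?_, h3⟩
      by_cases hd : y d = none
      · have := h2 d (by simpa [hM] using hd)
        simp only [hI] at this
        split_ifs at this with hxd
        · simpa [hxd, hx₀ d hd] using this
        · simpa [hxd, hx₀ d hd] using this.2
      · have h6 := (((unmaskPath_eq_iff hs.2).1 h5.2).1 d).not.1 hd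
        rw [hx d hd]
        simp only [hd, false_iff]
        exact fun h => h6 ⟨h.1, hsu.trans_lt h.2⟩
  have hprod : ∏ d ∈ M, (expMeasure 1).real (I d)
      = (Real.exp (-Γ s) - Real.exp (-Γ u)) ^ ((masked y).card - (masked x).card)
        * Real.exp (-Γ u) ^ (masked x).card := by
    have h1 : ∀ d ∈ M, (expMeasure 1).real (I d)
        = if x d = none then Real.exp (-Γ u) else Real.exp (-Γ s) - Real.exp (-Γ u) := by
      intro d _
      simp only [hI]
      split_ifs
      · exact expMeasure_real_Ioi ((hΓ0 s hs).trans hsu)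
      · exact expMeasure_real_Ioc (hΓ0 s hs) hsu
    have h2 : M.filter (fun d => x d = none) = masked x := by
      ext d
      simp only [Finset.mem_filter, mem_masked, hM]
      exact ⟨fun h => h.2, fun h => ⟨mem_masked.1 (hx.masked_subset (mem_masked.2 h)), h⟩⟩
    have h3 : (M.filter fun d => ¬ x d = none).card = (masked y).card - (masked x).card := by
      rw [Finset.filter_not, h2, Finset.card_sdiff_of_subset hx.masked_subset]
    rw [Finset.prod_congr rfl h1, Finset.prod_ite, Finset.prod_const, Finset.prod_const, h2, h3,
      mul_comm]
  rw [hset, Measure.real, unmaskMeasure, Measure.prod_prod,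
    pi_inter_box (fun _ : Fin D => expMeasure 1) M hBm hIm, ENNReal.toReal_mul,
    ENNReal.toReal_mul, ENNReal.toReal_prod]
  change (Measure.pi fun _ : Fin D => expMeasure 1).real _ * (∏ d ∈ M, (expMeasure 1).real (I d))
    * ((target U)[|agrees x₀]).real (agrees x) = _
  have hx₀x : Extends x₀ x := by
    intro d hd
    rw [hx d, hy d hd]
    rwa [hy d hd]
  rw [hprod, cond_target_agrees hN U hx₀x, transWeight, if_pos hx]
  ring

end UnmaskingChain

/-! ### The clock ∫ γ -/

section Clock

variable {T : ℝ} {γ : ℝ → ℝ}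

lemma intervalIntegrable_of_locallyIntegrableOn
    (hγ_loc : LocallyIntegrableOn γ (Set.Ico 0 T) volume) {a b : ℝ} (ha : a ∈ Set.Ico 0 T)
    (hb : b ∈ Set.Ico 0 T) : IntervalIntegrable γ volume a b := by
  rw [intervalIntegrable_iff']
  refine hγ_loc.integrableOn_compact_subset (fun u hu => ?_) isCompact_uIcc
  exact ⟨(le_min ha.1 hb.1).trans hu.1, hu.2.trans_lt (max_lt ha.2 hb.2)⟩

lemma monotoneOn_clock (hγ : ∀ t ∈ Set.Ico 0 T, 0 ≤ γ t)
    (hγ_loc : LocallyIntegrableOn γ (Set.Ico 0 T) volume) {t₀ : ℝ} (ht₀ : t₀ ∈ Set.Ico 0 T) :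
    MonotoneOn (fun t => ∫ u in t₀..t, γ u) (Set.Ico 0 T) := by
  intro s hs t ht hst
  have h := intervalIntegral.integral_add_adjacent_intervals
    (intervalIntegrable_of_locallyIntegrableOn hγ_loc ht₀ hs)
    (intervalIntegrable_of_locallyIntegrableOn hγ_loc hs ht)
  have h2 : 0 ≤ ∫ u in s..t, γ u := intervalIntegral.integral_nonneg hst fun u hu =>
    hγ u ⟨hs.1.trans hu.1, hu.2.trans_lt ht.2⟩
  simp only
  linarith

lemma continuousOn_clock (hγ_loc : LocallyIntegrableOn γ (Set.Ico 0 T) volume) {t₀ : ℝ}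
    (ht₀ : t₀ ∈ Set.Ico 0 T) :
    ContinuousOn (fun t => ∫ u in t₀..t, γ u) (Set.Ico t₀ T) := by
  intro t ht
  obtain ⟨b, hb⟩ := exists_between ht.2
  have hb' : b ∈ Set.Ico 0 T := ⟨ht₀.1.trans (ht.1.trans hb.1.le), hb.2⟩
  have h := intervalIntegral.continuousOn_primitive_interval'
    (intervalIntegrable_of_locallyIntegrableOn hγ_loc ht₀ hb') (Set.left_mem_uIcc)
  have htb : t₀ ≤ b := ht.1.trans hb.1.le
  rw [Set.uIcc_of_le htb] at h
  refine (h t ⟨ht.1, hb.1.le⟩).mono_of_mem_nhdsWithin ?_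
  filter_upwards [self_mem_nhdsWithin, mem_nhdsWithin_of_mem_nhds (Iio_mem_nhds hb.1)] with u h1 h2
  exact ⟨h1.1, h2.le⟩

/-- If the monotone clock stayed below M, monotone convergence over compact intervals would give γ
finite total mass. -/
lemma tendsto_clock (hγ : ∀ t ∈ Set.Ico 0 T, 0 ≤ γ t)
    (hγ_loc : LocallyIntegrableOn γ (Set.Ico 0 T) volume)
    (hγ_inf : ∫⁻ t in Set.Ico 0 T, ENNReal.ofReal (γ t) = ⊤) {t₀ : ℝ} (ht₀ : t₀ ∈ Set.Ico 0 T) :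
    Tendsto (fun t => ∫ u in t₀..t, γ u) (𝓝[<] T) atTop := by
  have hmono := monotoneOn_clock hγ hγ_loc ht₀
  have hT : (0 : ℝ) < T := ht₀.1.trans_lt ht₀.2
  have h0 : (0 : ℝ) ∈ Set.Ico 0 T := ⟨le_rfl, hT⟩
  refine tendsto_atTop.2 fun M => ?_
  suffices ∃ s ∈ Set.Ico 0 T, M ≤ ∫ u in t₀..s, γ u by
    obtain ⟨s, hs, hM⟩ := this
    filter_upwards [Ioo_mem_nhdsLT hs.2] with t ht
    exact hM.trans (hmono hs ⟨hs.1.trans ht.1.le, ht.2⟩ ht.1.le)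
  by_contra! hcon
  obtain ⟨u, hu, hum, hU⟩ := Ico_eq_iUnion_Icc hT
  have hle : ∫⁻ t in Set.Ico 0 T, ENNReal.ofReal (γ t)
      ≤ ENNReal.ofReal (M + ∫ v in (0 : ℝ)..t₀, γ v) := by
    rw [hU, setLIntegral_iUnion_of_directed]
    · refine iSup_le fun n => ?_
      have hint := intervalIntegrable_of_locallyIntegrableOn hγ_loc h0 (hu n)
      rw [← ofReal_integral_eq_lintegral_ofReal
        ((intervalIntegrable_iff_integrableOn_Icc_of_le (hu n).1).1 hint)]
      · rw [integral_Icc_eq_integral_Ioc, ← intervalIntegral.integral_of_le (hu n).1]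
        refine ENNReal.ofReal_le_ofReal ?_
        rw [← intervalIntegral.integral_add_adjacent_intervals
          (intervalIntegrable_of_locallyIntegrableOn hγ_loc h0 ht₀)
          (intervalIntegrable_of_locallyIntegrableOn hγ_loc ht₀ (hu n))]
        linarith [hcon (u n) (hu n)]
      · filter_upwards [ae_restrict_mem measurableSet_Icc] with t ht
        exact hγ t ⟨ht.1, ht.2.trans_lt (hu n).2⟩
    · exact (monotone_nat_of_le_succ fun n =>
        Set.Icc_subset_Icc_right (hum n.le_succ)).directed_le
  rw [hγ_inf] at hle
  exact absurd hle (by simp)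

end Clock

/-! ### The unmasking chain is a Markov chain with the tilted generator -/

section UnmaskingChain

variable {D N : ℕ} {T : ℝ} {γ : ℝ → ℝ}

/-- Revealed tokens never change, and a masked position satisfies a strict inequality that survives
for a while by continuity of the clock. -/
lemma unmaskPath_eventually_right {Γ : ℝ → ℝ} {t₀ : ℝ} {x₀ : State D N}
    (hΓ : MonotoneOn Γ (Set.Ico t₀ T)) (hc : ContinuousOn Γ (Set.Ico t₀ T))
    (ω : (Fin D → ℝ) × (Fin D → Fin N)) {t : ℝ} (ht : t ∈ Set.Ico t₀ T) :
    ∀ᶠ s in 𝓝[>] t, unmaskPath T Γ x₀ s ω = unmaskPath T Γ x₀ t ω := by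
  suffices ∀ d, ∀ᶠ s in 𝓝[>] t, unmaskPath T Γ x₀ s ω d = unmaskPath T Γ x₀ t ω d by
    filter_upwards [eventually_all.2 this] with s hs
    exact funext hs
  intro d
  by_cases hd : unmaskPath T Γ x₀ t ω d = none
  · have h := unmaskPath_eq_none.1 hd
    have h1 : ∀ᶠ s in 𝓝[>] t, Γ s < ω.1 d :=
      (((hc t ht).mono_of_mem_nhdsWithin (by
        filter_upwards [Ioo_mem_nhdsGT ht.2] with s hs
        exact ⟨ht.1.trans hs.1.le, hs.2⟩)).tendsto).eventually (gt_mem_nhds h.2.2)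
    filter_upwards [h1, Ioo_mem_nhdsGT ht.2] with s h2 h3
    rw [hd, unmaskPath_eq_none]
    exact ⟨h.1, h3.2, h2⟩
  · filter_upwards [Ioo_mem_nhdsGT ht.2] with s hs
    have := extends_unmaskPath (x₀ := x₀) (ω := ω) hΓ ht.1 hs.1.le hs.2
    exact this d hd

/-- Each coordinate changes at most once before T, so it is constant just before t. -/
lemma unmaskPath_eventually_left {Γ : ℝ → ℝ} {t₀ : ℝ} {x₀ : State D N}
    (hΓ : MonotoneOn Γ (Set.Ico t₀ T)) (ω : (Fin D → ℝ) × (Fin D → Fin N)) {t : ℝ}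
    (ht : t ∈ Set.Ioc t₀ T) : ∃ y, ∀ᶠ s in 𝓝[<] t, unmaskPath T Γ x₀ s ω = y := by
  suffices ∀ d, ∃ y, ∀ᶠ s in 𝓝[<] t, unmaskPath T Γ x₀ s ω d = y by
    choose y hy using this
    refine ⟨y, ?_⟩
    filter_upwards [eventually_all.2 hy] with s hs
    exact funext hs
  intro d
  by_cases h : ∀ s ∈ Set.Ico t₀ t, unmaskPath T Γ x₀ s ω d = none
  · refine ⟨none, ?_⟩
    filter_upwards [Ioo_mem_nhdsLT ht.1] with s hs
    exact h s ⟨hs.1.le, hs.2⟩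
  · push Not at h
    obtain ⟨s, hs, hne⟩ := h
    refine ⟨unmaskPath T Γ x₀ s ω d, ?_⟩
    filter_upwards [Ioo_mem_nhdsLT hs.2] with u hu
    exact extends_unmaskPath (x₀ := x₀) (ω := ω) hΓ hs.1 hu.1.le (hu.2.trans_le ht.2) d hne

/-- The path is fully revealed at T by definition, whatever value Γ takes at T. Divergence of the
clock ensures that every finite waiting time has been passed before T, so there is no jump at T. -/
lemma unmaskPath_eventually_terminal {Γ : ℝ → ℝ} {x₀ : State D N}
    (hlim : Tendsto Γ (𝓝[<] T) atTop) (ω : (Fin D → ℝ) × (Fin D → Fin N)) :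
    ∀ᶠ s in 𝓝[<] T, unmaskPath T Γ x₀ s ω = unmaskPath T Γ x₀ T ω := by
  suffices ∀ d, ∀ᶠ s in 𝓝[<] T, unmaskPath T Γ x₀ s ω d = unmaskPath T Γ x₀ T ω d by
    filter_upwards [eventually_all.2 this] with s hs
    exact funext hs
  intro d
  filter_upwards [hlim.eventually_ge_atTop (ω.1 d)] with s hs
  have h1 : unmaskPath T Γ x₀ s ω d ≠ none := by
    rw [Ne, unmaskPath_eq_none]
    exact fun h => h.2.2.not_ge hs
  have h2 : unmaskPath T Γ x₀ T ω d ≠ none := by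
    rw [Ne, unmaskPath_eq_none]
    exact fun h => h.2.1.false
  rw [unmaskPath_of_ne_none h1, unmaskPath_of_ne_none h2]

lemma measureReal_eq_sum_inter {Ω S : Type*} [MeasurableSpace Ω] [Fintype S] {P : Measure Ω}
    [IsFiniteMeasure P] {Y : Ω → S} (hY : ∀ y, MeasurableSet {ω | Y ω = y}) (B : Set Ω) :
    P.real B = ∑ y, P.real ({ω | Y ω = y} ∩ B) := by
  have h := sum_measureReal_preimage_singleton (μ := P.restrict B) (f := Y) Finset.univ
    (fun y _ => hY y)
  have h2 : Y ⁻¹' (↑(Finset.univ : Finset S) : Set S) = Set.univ := by ext; simp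
  rw [h2, measureReal_restrict_apply MeasurableSet.univ, Set.univ_inter] at h
  rw [← h]
  refine Finset.sum_congr rfl fun y _ => ?_
  exact measureReal_restrict_apply (hY y)

/-- The unmasking chain is a Markov chain with the optimal generator. -/
theorem isCTMC_unmaskPath (hN : 0 < N) (hγ : ∀ t ∈ Set.Ico 0 T, 0 ≤ γ t)
    (hγ_loc : LocallyIntegrableOn γ (Set.Ico 0 T) volume)
    (hγ_inf : ∫⁻ t in Set.Ico 0 T, ENNReal.ofReal (γ t) = ⊤) (U : (Fin D → Fin N) → ℝ)
    {t₀ : ℝ} (ht₀ : t₀ ∈ Set.Ico 0 T) (x₀ : State D N) :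
    IsCTMC T (tiltedGenerator (maskGenerator D N γ) fun _ => potential U) t₀ x₀
      (unmaskMeasure U x₀) (unmaskPath T (fun t => ∫ u in t₀..t, γ u) x₀) := by
  have hsub : Set.Ico t₀ T ⊆ Set.Ico 0 T := Set.Ico_subset_Ico_left ht₀.1
  have hmono := (monotoneOn_clock hγ hγ_loc ht₀).mono hsub
  have hcont := continuousOn_clock hγ_loc ht₀
  have hlim := tendsto_clock hγ hγ_loc hγ_inf ht₀
  have hnn : ∀ t ∈ Set.Ico t₀ T, 0 ≤ ∫ u in t₀..t, γ u := by
    intro t ht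
    have := hmono ⟨le_rfl, ht₀.2⟩ ht ht.1
    simpa using this
  set Γ : ℝ → ℝ := fun t => ∫ u in t₀..t, γ u with hΓ
  have hP := isProbabilityMeasure_unmaskMeasure hN U x₀
  refine ⟨hP, fun t _ x => measurableSet_unmaskPath_eq x,
    fun ω t ht => unmaskPath_eventually_right hmono hcont ω ht,
    fun ω t ht => unmaskPath_eventually_left hmono ω ht, ?_, ?_,
    Eventually.of_forall fun ω => unmaskPath_eventually_terminal hlim ω⟩
  · filter_upwards [ae_agrees_unmaskMeasure hN U x₀, ae_pos_unmaskMeasure hN U x₀] with ω h1 h2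
    rw [unmaskPath_eq_iff ht₀.2]
    refine ⟨fun d => ?_, h1⟩
    simp [hΓ, h2 d]
  · intro s t hs hst ht A hA y
    have hs' : s ∈ Set.Ico t₀ T := ⟨hs, hst.trans_lt ht⟩
    choose C hC using exists_transition_const (x₀ := x₀) hN U hmono hnn hs' hA
    -- Splitting by the state at time s, the probability depends on u only through the clock value Γ
    -- u.
    have hdec : ∀ u ∈ Set.Icc s t, ∀ x, (unmaskMeasure U x₀).real
        (A ∩ {ω | unmaskPath T Γ x₀ u ω = x}) = ∑ y, C y *
          transWeight (fun z => Real.exp (-U z)) (Real.exp (-Γ s)) y (Γ u) x := by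
      intro u hu x
      rw [measureReal_eq_sum_inter (Y := unmaskPath T Γ x₀ s)
        (fun y => measurableSet_unmaskPath_eq y)]
      refine Finset.sum_congr rfl fun y _ => ?_
      rw [← hC y u ⟨hu.1, hu.2.trans_lt ht⟩ x]
      congr 1
      ext ω
      simp only [Set.mem_inter_iff]
      tauto
    have hF : ∀ v, HasDerivAt (fun v => ∑ y', C y' *
        transWeight (fun z => Real.exp (-U z)) (Real.exp (-Γ s)) y' v y)
        (∑ y', C y' * ∑ x', transWeight (fun z => Real.exp (-U z)) (Real.exp (-Γ s)) y' v x'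
          * tiltedGenerator (maskGenerator D N fun _ => 1) (fun _ => potential U) 0 x' y) v :=
      fun v => HasDerivAt.fun_sum fun y' _ => (hasDerivAt_transWeight hN U _ y' y v).const_mul _
    have hF' : Continuous fun v => ∑ y', C y' * ∑ x',
        transWeight (fun z => Real.exp (-U z)) (Real.exp (-Γ s)) y' v x'
          * tiltedGenerator (maskGenerator D N fun _ => 1) (fun _ => potential U) 0 x' y :=
      continuous_finsetSum _ fun y' _ => continuous_const.mul <|
        continuous_finsetSum _ fun x' _ => (continuous_transWeight _ _ y' x').mul continuous_const
    -- The chain rule turns the forward equation in clock time into the one with rates γ u times the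
    -- homogeneous matrix.
    have key := integral_deriv_comp_primitive hF hF' hs hst
      (intervalIntegrable_of_locallyIntegrableOn hγ_loc ht₀ ⟨ht₀.1.trans (hs.trans hst), ht⟩)
    rw [hdec t ⟨hst, le_rfl⟩, hdec s ⟨le_rfl, hst⟩, ← key]
    refine intervalIntegral.integral_congr fun u hu => ?_
    rw [Set.uIcc_of_le hst] at hu
    simp only [hdec u hu, tiltedGenerator_eq_mul γ _ u]
    simp only [Finset.sum_mul, Finset.mul_sum]
    rw [Finset.sum_comm]
    exact Finset.sum_congr rfl fun x _ => Finset.sum_congr rfl fun y _ => by ring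

end UnmaskingChain

/-! ### Finite cost reveals all tokens; the value function -/

section Verification

variable {D N : ℕ} {T t₀ : ℝ} {γ : ℝ → ℝ} {Q : ℝ → State D N → State D N → ℝ} {x₀ : State D N}
  {Ω : Type} [MeasurableSpace Ω] {P : Measure Ω} {X : ℝ → Ω → State D N}

/-- Each masked position is revealed at total rate γ and lowers the count by one. The strictly
negative drift makes the mask count a useful test function. -/
lemma expDrift_card_masked (hN : 0 < N) (γ : ℝ → ℝ) (t : ℝ) (x : State D N) :
    expDrift (maskGenerator D N γ) (fun x => ((masked x).card : ℝ)) t x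
      = -((1 - Real.exp (-1)) * (γ t * (masked x).card)) := by
  have hN' : (N : ℝ) ≠ 0 := by positivity
  rw [expDrift, sum_maskGenerator_mul γ t x fun y =>
    Real.exp (((masked y).card : ℝ) - ((masked x).card : ℝ)) - 1]
  have h : ∀ d ∈ masked x, ∑ n, (Real.exp (((masked (setToken x d n)).card : ℝ)
      - ((masked x).card : ℝ)) - 1) = N * (Real.exp (-1) - 1) := by
    intro d hd
    have h1 : ∀ n, ((masked (setToken x d n)).card : ℝ) - ((masked x).card : ℝ) = -1 := by
      intro n
      rw [← card_masked_setToken (mem_masked.1 hd) n]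
      push_cast
      ring
    simp only [h1, Finset.sum_const, Finset.card_univ, Fintype.card_fin, nsmul_eq_mul]
  rw [Finset.sum_congr rfl h, Finset.sum_const, nsmul_eq_mul]
  field_simp
  ring

/-- Under a control of finite cost, all tokens are unmasked at the terminal time. -/
lemma IsCTMC.mean_card_masked_eq_zero (hX : IsCTMC T Q t₀ x₀ P X) (hN : 0 < N)
    (ht₀ : t₀ ∈ Set.Ico 0 T) (hγ : ∀ t ∈ Set.Ico 0 T, 0 ≤ γ t)
    (hγ_loc : LocallyIntegrableOn γ (Set.Ico 0 T) volume)
    (hγ_inf : ∫⁻ t in Set.Ico 0 T, ENNReal.ofReal (γ t) = ⊤) (hQ : IsGenerator T Q)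
    (hfin : runningCost T (maskGenerator D N γ) t₀ Q P X ≠ ⊤) :
    mean P X (fun x => ((masked x).card : ℝ)) T = 0 := by
  have hP := hX.prob
  set f : State D N → ℝ := fun x => ((masked x).card : ℝ) with hf
  have hQ₀ : IsGenerator T (maskGenerator D N γ) := isGenerator_maskGenerator hγ hγ_loc
  have hf0 : ∀ t, 0 ≤ mean P X f t := fun t =>
    Finset.sum_nonneg fun x _ => mul_nonneg measureReal_nonneg (Nat.cast_nonneg _)
  by_contra hne
  have hpos : 0 < mean P X f T := lt_of_le_of_ne (hf0 T) (Ne.symm hne)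
  set c : ℝ := 1 - Real.exp (-1) with hc
  have hc0 : 0 < c := by
    have : Real.exp (-1) < 1 := by simp
    linarith
  -- The verification inequality for the mask count, with its nonnegative mean at time t dropped.
  have hbound : ∀ t ∈ Set.Ico t₀ T, c * ∫ u in t₀..t, γ u * mean P X f u
      ≤ (runningCost T (maskGenerator D N γ) t₀ Q P X).toReal + f x₀ := by
    intro t ht
    have h1 := hX.le_runningCost hQ hQ₀ ht₀.1 f ht
    rw [ENNReal.ofReal_le_iff_le_toReal hfin] at h1
    have h2 : ∫ u in t₀..t, ∑ x, P.real {ω | X u ω = x} * expDrift (maskGenerator D N γ) f u x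
        = -(c * ∫ u in t₀..t, γ u * mean P X f u) := by
      rw [← intervalIntegral.integral_const_mul, ← intervalIntegral.integral_neg]
      refine intervalIntegral.integral_congr fun u _ => ?_
      simp only [hf, expDrift_card_masked hN, mean, Finset.mul_sum]
      rw [← Finset.sum_neg_distrib]
      exact Finset.sum_congr rfl fun x _ => by ring
    rw [h2] at h1
    linarith [hf0 t]
  -- If the limit at T is positive, the mean exceeds half of it near T, and the left side of the
  -- bound grows like the divergent clock.
  have hev : ∀ᶠ t in 𝓝[<] T, mean P X f T / 2 < mean P X f t :=
    (hX.tendsto_mean ht₀.2 f).eventually (lt_mem_nhds (half_lt_self hpos))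
  obtain ⟨t₁, ht₁, h1⟩ := mem_nhdsLT_iff_exists_Ioo_subset.1
    (Filter.inter_mem hev (Ioo_mem_nhdsLT ht₀.2))
  obtain ⟨s, hs⟩ := exists_between (Set.mem_Iio.1 ht₁)
  have hs₀ : t₀ ≤ s := (h1 ⟨hs.1, hs.2⟩).2.1.le
  have hsI : s ∈ Set.Ico 0 T := ⟨ht₀.1.trans hs₀, hs.2⟩
  have hlim := (tendsto_clock hγ hγ_loc hγ_inf hsI).const_mul_atTop
    (mul_pos hc0 (half_pos hpos))
  obtain ⟨t, h2, h3⟩ := ((hlim.eventually_gt_atTop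
    ((runningCost T (maskGenerator D N γ) t₀ Q P X).toReal + f x₀)).and
      (Ioo_mem_nhdsLT hs.2)).exists
  have htI : t ∈ Set.Ico t₀ T := ⟨hs₀.trans h3.1.le, h3.2⟩
  have htI' : t ∈ Set.Ico 0 T := ⟨ht₀.1.trans htI.1, h3.2⟩
  have hint : IntegrableOn (fun u => γ u * mean P X f u) (Set.Icc t₀ t) := by
    have h4 := (intervalIntegrable_iff_integrableOn_Icc_of_le htI.1).1
      (intervalIntegrable_of_locallyIntegrableOn hγ_loc ht₀ htI')
    have h5 : (fun u => γ u * mean P X f u)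
        = fun u => ∑ x, P.real {ω | X u ω = x} * (γ u * f x) := by
      funext u
      simp only [mean, Finset.mul_sum]
      exact Finset.sum_congr rfl fun x _ => by ring
    rw [h5]
    exact integrable_finsetSum _ fun x _ =>
      hX.integrableOn_real_mul x le_rfl h3.2 (h4.mul_const _)
  have h6 : (mean P X f T / 2) * ∫ u in s..t, γ u ≤ ∫ u in s..t, γ u * mean P X f u := by
    rw [← intervalIntegral.integral_const_mul]
    refine intervalIntegral.integral_mono_on_of_le_Ioo h3.1.le
      ((intervalIntegrable_of_locallyIntegrableOn hγ_loc hsI htI').const_mul _) ?_ ?_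
    · rw [intervalIntegrable_iff_integrableOn_Icc_of_le h3.1.le]
      exact hint.mono_set (Set.Icc_subset_Icc_left hs₀)
    · intro u hu
      have h7 : mean P X f T / 2 < mean P X f u := (h1 ⟨hs.1.trans hu.1, hu.2.trans h3.2⟩).1
      have h8 := hγ u ⟨hsI.1.trans hu.1.le, hu.2.trans h3.2⟩
      nlinarith
  have h9 : ∫ u in s..t, γ u * mean P X f u ≤ ∫ u in t₀..t, γ u * mean P X f u := by
    refine intervalIntegral.integral_mono_interval hs₀ h3.1.le le_rfl ?_ ?_
    · filter_upwards [ae_restrict_mem measurableSet_Ioc] with u hu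
      exact mul_nonneg (hγ u ⟨ht₀.1.trans hu.1.le, hu.2.trans_lt h3.2⟩) (hf0 u)
    · rwa [intervalIntegrable_iff_integrableOn_Icc_of_le htI.1]
  have h10 := hbound t htI
  have h11 := mul_le_mul_of_nonneg_left (h6.trans h9) hc0.le
  rw [← mul_assoc] at h11
  linarith

lemma prob_eq_zero_of_mean_card_masked {t : ℝ}
    (h : mean P X (fun x => ((masked x).card : ℝ)) t = 0) {x : State D N} (hx : masked x ≠ ∅) :
    P.real {ω | X t ω = x} = 0 := by
  have h1 := (Finset.sum_eq_zero_iff_of_nonneg fun x _ =>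
    mul_nonneg measureReal_nonneg (Nat.cast_nonneg _)).1 h x (Finset.mem_univ x)
  rcases mul_eq_zero.1 h1 with h2 | h2
  · exact h2
  · exact absurd (Finset.card_eq_zero.1 (Nat.cast_eq_zero.1 h2)) hx

/-- Terminal means only depend on unmasked sequences if all tokens are unmasked. -/
lemma mean_congr_of_mean_card_masked {t : ℝ}
    (h : mean P X (fun x => ((masked x).card : ℝ)) t = 0) {f g : State D N → ℝ}
    (hfg : ∀ z, f (embed z) = g (embed z)) : mean P X f t = mean P X g t := by
  refine Finset.sum_congr rfl fun x _ => ?_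
  by_cases hx : masked x = ∅
  · obtain ⟨z, rfl⟩ := exists_embed_of_masked_eq_empty hx
    rw [hfg]
  · rw [prob_eq_zero_of_mean_card_masked h hx, zero_mul, zero_mul]

variable {U : (Fin D → Fin N) → ℝ} {r : State D N → ℝ}

/-- Every control costs at least `-potential U x₀`. -/
lemma IsCTMC.neg_potential_le_controlCost (hX : IsCTMC T Q t₀ x₀ P X) (hN : 0 < N)
    (ht₀ : t₀ ∈ Set.Ico 0 T) (hγ : ∀ t ∈ Set.Ico 0 T, 0 ≤ γ t)
    (hγ_loc : LocallyIntegrableOn γ (Set.Ico 0 T) volume)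
    (hγ_inf : ∫⁻ t in Set.Ico 0 T, ENNReal.ofReal (γ t) = ⊤) (hQ : IsGenerator T Q)
    (hr : ∀ z, r (embed z) = -U z - Real.log (1 / (N : ℝ) ^ D)) :
    ((-potential U x₀ : ℝ) : EReal) ≤ controlCost T (maskGenerator D N γ) r t₀ Q P X := by
  rw [hX.controlCost_eq ht₀.2.le]
  by_cases hfin : runningCost T (maskGenerator D N γ) t₀ Q P X = ⊤
  · rw [hfin, EReal.coe_ennreal_top, EReal.top_sub_coe]
    exact le_top
  have hQ₀ : IsGenerator T (maskGenerator D N γ) := isGenerator_maskGenerator hγ hγ_loc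
  have h0 := hX.mean_card_masked_eq_zero hN ht₀ hγ hγ_loc hγ_inf hQ hfin
  -- Without masks at T, the reward and the potential have equal means although they may differ on
  -- masked sequences.
  have hrV : mean P X r T = mean P X (potential U) T :=
    mean_congr_of_mean_card_masked h0 fun z => by rw [hr, potential_embed]
  have hle : mean P X (potential U) T - potential U x₀
      ≤ (runningCost T (maskGenerator D N γ) t₀ Q P X).toReal := by
    refine le_of_tendsto ((hX.tendsto_mean ht₀.2 (potential U)).sub_const _) ?_
    filter_upwards [Ioo_mem_nhdsLT ht₀.2] with t ht
    have h1 := hX.le_runningCost hQ hQ₀ ht₀.1 (potential U) ⟨ht.1.le, ht.2⟩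
    rw [ENNReal.ofReal_le_iff_le_toReal hfin] at h1
    simpa [expDrift_potential hN] using h1
  rw [← ENNReal.ofReal_toReal hfin, EReal.coe_ennreal_ofReal,
    max_eq_left ENNReal.toReal_nonneg, ← EReal.coe_sub, EReal.coe_le_coe_iff, hrV]
  linarith

/-- The optimal generator costs `-potential U x₀`. -/
lemma IsCTMC.controlCost_tiltedGenerator
    (hX : IsCTMC T (tiltedGenerator (maskGenerator D N γ) fun _ => potential U) t₀ x₀ P X)
    (hN : 0 < N) (ht₀ : t₀ ∈ Set.Ico 0 T) (hγ : ∀ t ∈ Set.Ico 0 T, 0 ≤ γ t)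
    (hγ_loc : LocallyIntegrableOn γ (Set.Ico 0 T) volume)
    (hγ_inf : ∫⁻ t in Set.Ico 0 T, ENNReal.ofReal (γ t) = ⊤)
    (hr : ∀ z, r (embed z) = -U z - Real.log (1 / (N : ℝ) ^ D)) :
    controlCost T (maskGenerator D N γ) r t₀
      (tiltedGenerator (maskGenerator D N γ) fun _ => potential U) P X
        = ((-potential U x₀ : ℝ) : EReal) := by
  have hQ₀ : IsGenerator T (maskGenerator D N γ) := isGenerator_maskGenerator hγ hγ_loc
  have hQ := isGenerator_tiltedGenerator hγ hγ_loc (potential U)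
  obtain ⟨h1, h2⟩ := hX.runningCost_of_tilted hQ hQ₀ ht₀.1 ht₀.2 (potential U)
    (fun t _ x => expDrift_potential hN γ U t x)
    (fun t _ x y hy => tiltedGenerator_of_ne _ _ t hy)
  have h0 := hX.mean_card_masked_eq_zero hN ht₀ hγ hγ_loc hγ_inf hQ
    (by rw [h1]; exact ENNReal.ofReal_ne_top)
  have hrV : mean P X r T = mean P X (potential U) T :=
    mean_congr_of_mean_card_masked h0 fun z => by rw [hr, potential_embed]
  rw [hX.controlCost_eq ht₀.2.le, h1, EReal.coe_ennreal_ofReal, max_eq_left h2,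
    ← EReal.coe_sub, hrV]
  congr 1
  ring

/-- The infimum `-potential U x₀` of the costs is attained by the unmasking chain. -/
lemma isLeast_attainableCosts (hN : 0 < N) (ht₀ : t₀ ∈ Set.Ico 0 T)
    (hγ : ∀ t ∈ Set.Ico 0 T, 0 ≤ γ t) (hγ_loc : LocallyIntegrableOn γ (Set.Ico 0 T) volume)
    (hγ_inf : ∫⁻ t in Set.Ico 0 T, ENNReal.ofReal (γ t) = ⊤)
    (hr : ∀ z, r (embed z) = -U z - Real.log (1 / (N : ℝ) ^ D)) (x₀ : State D N) :
    IsLeast (attainableCosts T (maskGenerator D N γ) r t₀ x₀)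
      ((-potential U x₀ : ℝ) : EReal) := by
  constructor
  · have hX := isCTMC_unmaskPath hN hγ hγ_loc hγ_inf U ht₀ x₀
    exact ⟨_, isGenerator_tiltedGenerator hγ hγ_loc (potential U), _, _, _, _, hX,
      (hX.controlCost_tiltedGenerator hN ht₀ hγ hγ_loc hγ_inf hr).symm⟩
  · rintro c ⟨Q, hQ, Ω, _, P, X, hX, rfl⟩
    exact hX.neg_potential_le_controlCost hN ht₀ hγ hγ_loc hγ_inf hQ hr

lemma isOptimal_tiltedGenerator (hN : 0 < N) (ht₀ : t₀ ∈ Set.Ico 0 T)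
    (hγ : ∀ t ∈ Set.Ico 0 T, 0 ≤ γ t) (hγ_loc : LocallyIntegrableOn γ (Set.Ico 0 T) volume)
    (hγ_inf : ∫⁻ t in Set.Ico 0 T, ENNReal.ofReal (γ t) = ⊤)
    (hr : ∀ z, r (embed z) = -U z - Real.log (1 / (N : ℝ) ^ D)) (x₀ : State D N) :
    IsOptimal T (maskGenerator D N γ) r t₀ x₀
      (tiltedGenerator (maskGenerator D N γ) fun _ => potential U) := by
  have hX := isCTMC_unmaskPath hN hγ hγ_loc hγ_inf U ht₀ x₀
  refine ⟨isGenerator_tiltedGenerator hγ hγ_loc (potential U), _, _, _, _, hX, ?_⟩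
  rw [hX.controlCost_tiltedGenerator hN ht₀ hγ hγ_loc hγ_inf hr]
  exact isLeast_attainableCosts hN ht₀ hγ hγ_loc hγ_inf hr x₀

lemma valueFunction_eq (hN : 0 < N) (ht₀ : t₀ ∈ Set.Ico 0 T)
    (hγ : ∀ t ∈ Set.Ico 0 T, 0 ≤ γ t) (hγ_loc : LocallyIntegrableOn γ (Set.Ico 0 T) volume)
    (hγ_inf : ∫⁻ t in Set.Ico 0 T, ENNReal.ofReal (γ t) = ⊤)
    (hr : ∀ z, r (embed z) = -U z - Real.log (1 / (N : ℝ) ^ D)) (x₀ : State D N) :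
    valueFunction T (maskGenerator D N γ) r t₀ x₀ = (potential U x₀ : EReal) := by
  rw [valueFunction, (isLeast_attainableCosts hN ht₀ hγ hγ_loc hγ_inf hr x₀).csInf_eq,
    EReal.coe_neg, neg_neg]

/-! ### The reference chain -/

/-- The initial state is almost surely constant, so each of its events is null or almost sure. -/
lemma IsCTMC.indep_start (hX : IsCTMC T Q t₀ x₀ P X) (x y : State D N) (t : ℝ) :
    P.real ({ω | X t₀ ω = x} ∩ {ω | X t ω = y})
      = P.real {ω | X t₀ ω = x} * P.real {ω | X t ω = y} := by
  have hP := hX.prob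
  by_cases hx : x₀ = x
  · have h1 : {ω | X t₀ ω = x} =ᵐ[P] Set.univ := by
      filter_upwards [hX.start] with ω hω
      exact eq_true (hω.trans hx)
    have h2 : P.real ({ω | X t₀ ω = x} ∩ {ω | X t ω = y}) = P.real (Set.univ ∩ {ω | X t ω = y}) :=
      measureReal_congr (ae_eq_set_inter h1 (ae_eq_refl _))
    rw [h2, measureReal_congr h1, Set.univ_inter,
      probReal_univ, one_mul]
  · have h1 : {ω | X t₀ ω = x} =ᵐ[P] (∅ : Set Ω) := by
      filter_upwards [hX.start] with ω hω
      exact eq_false fun h : X t₀ ω = x => hx (hω.symm.trans h)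
    have h2 : P.real ({ω | X t₀ ω = x} ∩ {ω | X t ω = y}) = P.real (∅ ∩ {ω | X t ω = y}) :=
      measureReal_congr (ae_eq_set_inter h1 (ae_eq_refl _))
    rw [h2, measureReal_congr h1, Set.empty_inter,
      measureReal_empty, zero_mul]

/-- The reference chain ends in the uniform distribution. -/
lemma IsCTMC.uniform_terminal
    (hX : IsCTMC T (maskGenerator D N γ) 0 (fullMask D N) P X)
    (hN : 0 < N) (hT : 0 < T) (hγ : ∀ t ∈ Set.Ico 0 T, 0 ≤ γ t)
    (hγ_loc : LocallyIntegrableOn γ (Set.Ico 0 T) volume)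
    (hγ_inf : ∫⁻ t in Set.Ico 0 T, ENNReal.ofReal (γ t) = ⊤) (z : Fin D → Fin N) :
    P.real {ω | X T ω = embed z} = 1 / (N : ℝ) ^ D := by
  classical
  have hP := hX.prob
  have h00 : (0 : ℝ) ∈ Set.Ico 0 T := ⟨le_rfl, hT⟩
  have hQ₀ : IsGenerator T (maskGenerator D N γ) := isGenerator_maskGenerator hγ hγ_loc
  -- The untilted case f = 0: the reference control has finite cost, so it too leaves no masks at T.
  have hcost := (hX.runningCost_of_tilted hQ₀ hQ₀ le_rfl hT (fun _ => 0)
    (fun t _ x => by simp [expDrift]) (fun t _ x y _ => by simp)).1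
  have h0 := hX.mean_card_masked_eq_zero hN h00 hγ hγ_loc hγ_inf hQ₀
    (by rw [hcost]; exact ENNReal.ofReal_ne_top)
  -- The completion mean of this point indicator has constant expectation along the chain. It starts
  -- at 1 / N ^ D, and on unmasked sequences it is the indicator of z.
  set w : (Fin D → Fin N) → ℝ := fun z' => if z' = z then 1 else 0 with hw
  have hharm : ∀ t ∈ Set.Ico 0 T, ∀ x,
      ∑ y, maskGenerator D N γ t x y * completionMean w y = 0 := by
    intro t ht x
    rw [hQ₀.sum_mul _ ht x]
    simp only [mul_comm _ (maskGenerator D N γ t x _)]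
    rw [sum_maskGenerator_mul γ t x fun y => completionMean w y - completionMean w x,
      Finset.sum_eq_zero fun d hd => sum_completionMean_setToken hN w (mem_masked.1 hd), mul_zero]
  have hconst : ∀ t ∈ Set.Ico 0 T,
      mean P X (completionMean w) t = completionMean w (fullMask D N) := by
    intro t ht
    have h1 := hX.dynkin hQ₀ le_rfl (completionMean w) le_rfl ht.1 ht.2
    rw [hX.mean_start, intervalIntegral.integral_zero_ae] at h1
    · linarith
    · refine Eventually.of_forall fun u hu => ?_
      rw [Set.uIoc_of_le ht.1] at hu
      simp [hharm u ⟨hu.1.le, hu.2.trans_lt ht.2⟩]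
  have hlim : mean P X (completionMean w) T = completionMean w (fullMask D N) := by
    refine tendsto_nhds_unique (hX.tendsto_mean hT (completionMean w))
      (tendsto_const_nhds.congr' ?_)
    filter_upwards [Ioo_mem_nhdsLT hT] with t ht
    exact (hconst t ⟨ht.1.le, ht.2⟩).symm
  have hfull : completionMean w (fullMask D N) = 1 / (N : ℝ) ^ D := by
    have h1 : masked (fullMask D N) = Finset.univ := by
      ext d
      simp [fullMask]
    have h2 : agrees (fullMask D N) = Set.univ := by
      ext z'
      simp [agrees, fullMask]
    rw [completionMean, agreeSum, h1, h2]
    simp [hw]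
  have hT' : mean P X (completionMean w) T
      = mean P X (fun x => if x = embed z then 1 else 0) T := by
    refine mean_congr_of_mean_card_masked h0 fun z' => ?_
    have hinj : (embed z' = embed z) ↔ z' = z :=
      ⟨fun h => funext fun d => Option.some_injective _ (congrFun h d), fun h => h ▸ rfl⟩
    simp only [completionMean, agreeSum_embed, masked_embed, hinj, hw]
    simp
  rw [← hfull, ← hlim, hT']
  simp [mean]

end Verification

/-! ### Occupied states and uniqueness -/

section Uniqueness

variable {D N : ℕ} {T : ℝ} {γ : ℝ → ℝ} {Q : ℝ → State D N → State D N → ℝ}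
  {Ω : Type} [MeasurableSpace Ω] {P : Measure Ω} {X : ℝ → Ω → State D N}
  {U : (Fin D → Fin N) → ℝ}

/-- The forward equation of a chain with the optimal rates, with an integrating factor. -/
lemma IsCTMC.mul_exp_clock_eq {x₀ : State D N} (hX : IsCTMC T Q 0 x₀ P X)
    (hN : 0 < N) (hγ : ∀ t ∈ Set.Ico 0 T, 0 ≤ γ t)
    (hγ_loc : LocallyIntegrableOn γ (Set.Ico 0 T) volume)
    (hae : ∀ᵐ t ∂(volume.restrict (Set.Ico 0 T)), ∀ x, 0 < P.real {ω | X t ω = x} →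
      ∀ y, Q t x y = tiltedGenerator (maskGenerator D N γ) (fun _ => potential U) t x y)
    (y : State D N) {t : ℝ} (ht : t ∈ Set.Ico 0 T) :
    P.real {ω | X t ω = y} * Real.exp ((masked y).card * ∫ v in (0 : ℝ)..t, γ v)
      = P.real {ω | X 0 ω = y} + ∫ u in (0 : ℝ)..t, (γ u * ∑ x ∈ Finset.univ.erase y,
        P.real {ω | X u ω = x}
          * tiltedGenerator (maskGenerator D N fun _ => 1) (fun _ => potential U) 0 x y)
          * Real.exp ((masked y).card * ∫ v in (0 : ℝ)..u, γ v) := by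
  have hP := hX.prob
  have hT : (0 : ℝ) < T := ht.1.trans_lt ht.2
  have hQs := isGenerator_tiltedGenerator (D := D) (N := N) hγ hγ_loc (potential U)
  refine mul_exp_eq_of_linear (p := fun t => P.real {ω | X t ω = y})
    (f := fun u => ∑ x, P.real {ω | X u ω = x}
      * tiltedGenerator (maskGenerator D N γ) (fun _ => potential U) u x y) _ ht.1
    (intervalIntegrable_of_locallyIntegrableOn hγ_loc ⟨le_rfl, hT⟩ ht) ?_ ?_ ?_
  · rw [intervalIntegrable_iff_integrableOn_Icc_of_le ht.1]
    exact integrable_finsetSum _ fun x _ => hX.integrableOn_real_mul x le_rfl ht.2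
      (hQs.integrableOn_Icc le_rfl ht.2 x y)
  · intro s hs
    have h1 := hX.forward 0 s le_rfl hs.1 (hs.2.trans_lt ht.2) Set.univ MeasurableSet.univ y
    simp only [Set.univ_inter] at h1
    rw [← sub_eq_iff_eq_add', h1]
    refine intervalIntegral.integral_congr_ae ?_
    -- The rates of Q may be replaced by the optimal ones: they agree in occupied states, and the
    -- other states have weight zero.
    filter_upwards [(ae_restrict_iff' measurableSet_Ico).1 hae] with u hu hmem
    rw [Set.uIoc_of_le hs.1] at hmem
    refine Finset.sum_congr rfl fun x _ => ?_
    rcases (measureReal_nonneg (μ := P) (s := {ω | X u ω = x})).eq_or_lt with h | h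
    · rw [← h, zero_mul, zero_mul]
    · rw [hu ⟨hmem.1.le, hmem.2.trans_lt (hs.2.trans_lt ht.2)⟩ x h y]
  · intro u _
    rw [← Finset.add_sum_erase _ _ (Finset.mem_univ y), tiltedGenerator_diag hN, Finset.mul_sum]
    rw [Finset.sum_congr rfl fun x _ => by
      rw [tiltedGenerator_eq_mul γ (potential U) u x y, mul_left_comm]]
    ring

/-- A chain with the optimal rates reaches every state once the clock has started. -/
lemma IsCTMC.prob_pos (hX : IsCTMC T Q 0 (fullMask D N) P X)
    (hN : 0 < N) (hγ : ∀ t ∈ Set.Ico 0 T, 0 ≤ γ t)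
    (hγ_loc : LocallyIntegrableOn γ (Set.Ico 0 T) volume)
    (hae : ∀ᵐ t ∂(volume.restrict (Set.Ico 0 T)), ∀ x, 0 < P.real {ω | X t ω = x} →
      ∀ y, Q t x y = tiltedGenerator (maskGenerator D N γ) (fun _ => potential U) t x y)
    (y : State D N) {t : ℝ} (ht : t ∈ Set.Ico 0 T)
    (hy : y = fullMask D N ∨ 0 < ∫ v in (0 : ℝ)..t, γ v) : 0 < P.real {ω | X t ω = y} := by
  have hP := hX.prob
  have hT : (0 : ℝ) < T := ht.1.trans_lt ht.2
  have h00 : (0 : ℝ) ∈ Set.Ico 0 T := ⟨le_rfl, hT⟩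
  set q := tiltedGenerator (maskGenerator D N fun _ => 1) (fun _ => potential U) 0 with hq
  have hqn : ∀ x y, x ≠ y → 0 ≤ q x y := by
    intro x y h
    rw [hq, tiltedGenerator_of_ne _ _ _ h.symm]
    exact mul_nonneg (maskGenerator_nonneg zero_le_one h) (Real.exp_pos _).le
  have hg : ∀ u y, 0 ≤ ∑ x ∈ Finset.univ.erase y, P.real {ω | X u ω = x} * q x y :=
    fun u y => Finset.sum_nonneg fun x hx =>
      mul_nonneg measureReal_nonneg (hqn x y (Finset.ne_of_mem_erase hx))
  have hnn : ∀ y, ∀ u ∈ Set.Ico 0 T, 0 ≤ (γ u * ∑ x ∈ Finset.univ.erase y,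
      P.real {ω | X u ω = x} * q x y) * Real.exp ((masked y).card * ∫ v in (0 : ℝ)..u, γ v) :=
    fun y u hu => mul_nonneg (mul_nonneg (hγ u hu) (hg u y)) (Real.exp_pos _).le
  -- The initial mass is one and the inflow is nonnegative, so the weighted probability of the full
  -- mask never drops below one.
  have hstart : ∀ t ∈ Set.Ico 0 T, 0 < P.real {ω | X t ω = fullMask D N} := by
    intro t ht
    have h1 := hX.mul_exp_clock_eq hN hγ hγ_loc hae (fullMask D N) ht
    have h2 : P.real {ω | X 0 ω = fullMask D N} = 1 := by
      have := hX.mean_start fun x => if x = fullMask D N then 1 else 0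
      simpa [mean] using this
    have h3 := intervalIntegral.integral_nonneg (μ := volume) ht.1 fun u hu =>
      hnn (fullMask D N) u ⟨hu.1, hu.2.trans_lt ht.2⟩
    rw [h2] at h1
    refine (mul_pos_iff_of_pos_right (Real.exp_pos
      ((masked (fullMask D N)).card * ∫ v in (0 : ℝ)..t, γ v))).1 ?_
    rw [h1]
    linarith
  -- Induction on the number of revealed tokens; the predecessor remasks one of them.
  suffices ∀ k, ∀ y : State D N, ((masked y)ᶜ).card = k → ∀ t ∈ Set.Ico 0 T,
      (y = fullMask D N ∨ 0 < ∫ v in (0 : ℝ)..t, γ v) → 0 < P.real {ω | X t ω = y} from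
    this _ y rfl t ht hy
  intro k
  induction k with
  | zero =>
    intro y hk t ht _
    have : y = fullMask D N := by
      funext d
      have h1 := Finset.card_eq_zero.1 hk
      have h2 : d ∉ (masked y)ᶜ := by simp [h1]
      simpa [fullMask] using h2
    exact this ▸ hstart t ht
  | succ k ih =>
    intro y hk t ht hy
    rcases hy with rfl | hy
    · exact hstart t ht
    obtain ⟨d, hd⟩ : ((masked y)ᶜ).Nonempty := by
      rw [← Finset.card_pos]
      omega
    have hd' : y d ≠ none := by simpa using hd
    obtain ⟨n, hn⟩ := Option.ne_none_iff_exists'.1 hd'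
    set x := remask y d with hx
    have hxy : setToken x d n = y := setToken_remask hn
    have hxd : x d = none := remask_same y d
    have hxk : ((masked x)ᶜ).card = k := by
      have h1 := card_masked_setToken hxd n
      rw [hxy] at h1
      rw [Finset.card_compl] at hk ⊢
      have h2 := Finset.card_le_univ (masked x)
      omega
    have hxne : x ≠ y := by
      rw [← hxy]
      exact (setToken_ne hxd n).symm
    have hqpos : 0 < q x y := by
      rw [hq, ← hxy, tiltedGenerator_setToken hN (fun _ => 1) U 0 hxd n, one_mul]
      exact div_pos (agreeSum_pos hN (fun z => Real.exp_pos _) _)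
        (agreeSum_pos hN (fun z => Real.exp_pos _) _)
    -- At half the clock value, the clock is already positive on (t₁, t], so the predecessor is
    -- occupied there, yet half of the clock's mass remains.
    obtain ⟨t₁, ht₁, hΓ₁⟩ : ∃ t₁ ∈ Set.Icc 0 t,
        (∫ v in (0 : ℝ)..t₁, γ v) = (∫ v in (0 : ℝ)..t, γ v) / 2 := by
      have hc := (continuousOn_clock hγ_loc h00).mono
        (fun u hu => ⟨hu.1, hu.2.trans_lt ht.2⟩ : Set.Icc 0 t ⊆ Set.Ico 0 T)
      refine intermediate_value_Icc ht.1 hc ⟨?_, ?_⟩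
      · simpa using (half_pos hy).le
      · exact (half_lt_self hy).le
    have ht₁' : t₁ ∈ Set.Ico 0 T := ⟨ht₁.1, ht₁.2.trans_lt ht.2⟩
    by_contra hcon
    have hp0 : P.real {ω | X t ω = y} = 0 := le_antisymm (not_lt.1 hcon) measureReal_nonneg
    have h1 := hX.mul_exp_clock_eq hN hγ hγ_loc hae y ht
    rw [hp0, zero_mul] at h1
    set F : ℝ → ℝ := fun u => (γ u * ∑ x ∈ Finset.univ.erase y,
      P.real {ω | X u ω = x} * q x y) * Real.exp ((masked y).card * ∫ v in (0 : ℝ)..u, γ v) with hF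
    have hFnn : ∀ u ∈ Set.Icc 0 t, 0 ≤ F u := fun u hu => hnn y u ⟨hu.1, hu.2.trans_lt ht.2⟩
    have hFint : IntegrableOn F (Set.Icc 0 t) := by
      have hγi := (intervalIntegrable_iff_integrableOn_Icc_of_le ht.1).1
        (intervalIntegrable_of_locallyIntegrableOn hγ_loc h00 ht)
      have h2 : IntegrableOn (fun u => γ u * ∑ x ∈ Finset.univ.erase y,
          P.real {ω | X u ω = x} * q x y) (Set.Icc 0 t) := by
        simp only [Finset.mul_sum, mul_left_comm (γ _)]
        exact integrable_finsetSum _ fun x _ => hX.integrableOn_real_mul x le_rfl ht.2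
          (hγi.mul_const _)
      refine h2.mul_continuousOn ?_ isCompact_Icc
      have hc := (continuousOn_clock hγ_loc h00).mono
        (fun u hu => ⟨hu.1, hu.2.trans_lt ht.2⟩ : Set.Icc 0 t ⊆ Set.Ico 0 T)
      exact Real.continuous_exp.comp_continuousOn (continuousOn_const.mul hc)
    have hF0 : ∫ u in Set.Icc 0 t, F u = 0 := by
      rw [integral_Icc_eq_integral_Ioc, ← intervalIntegral.integral_of_le ht.1]
      refine le_antisymm ?_ (intervalIntegral.integral_nonneg ht.1 hFnn)
      have h3 : 0 ≤ P.real {ω | X 0 ω = y} := measureReal_nonneg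
      have h4 : (0 : ℝ) = P.real {ω | X 0 ω = y} + ∫ u in (0 : ℝ)..t, F u := h1
      linarith
    have hFae := (integral_eq_zero_iff_of_nonneg_ae
      ((ae_restrict_iff' measurableSet_Icc).2 (Eventually.of_forall hFnn)) hFint).1 hF0
    -- If y had probability zero at time t, the inflow would vanish almost everywhere. Its factor
    -- from the predecessor is positive on (t₁, t], so γ would vanish there, contradicting the
    -- remaining mass.
    have hγ0 : ∫ u in t₁..t, γ u = 0 := by
      refine intervalIntegral.integral_zero_ae ?_
      filter_upwards [(ae_restrict_iff' measurableSet_Icc).1 hFae] with u hu hmem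
      rw [Set.uIoc_of_le ht₁.2] at hmem
      have hu' : u ∈ Set.Ico 0 T := ⟨ht₁.1.trans hmem.1.le, hmem.2.trans_lt ht.2⟩
      have h2 : F u = 0 := hu ⟨hu'.1, hmem.2⟩
      have hΓu : 0 < ∫ v in (0 : ℝ)..u, γ v := by
        have := monotoneOn_clock hγ hγ_loc h00 ht₁' hu' hmem.1.le
        simp only [hΓ₁] at this
        linarith
      have hpx := ih x hxk u hu' (Or.inr hΓu)
      have hgpos : 0 < ∑ x ∈ Finset.univ.erase y, P.real {ω | X u ω = x} * q x y :=
        Finset.sum_pos' (fun x hx => mul_nonneg measureReal_nonneg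
          (hqn x y (Finset.ne_of_mem_erase hx)))
          ⟨x, Finset.mem_erase.2 ⟨hxne, Finset.mem_univ x⟩, mul_pos hpx hqpos⟩
      exact (mul_eq_zero.1 ((mul_eq_zero.1 h2).resolve_right
        (Real.exp_pos _).ne')).resolve_right hgpos.ne'
    have hadd := intervalIntegral.integral_add_adjacent_intervals
      (intervalIntegrable_of_locallyIntegrableOn hγ_loc h00 ht₁')
      (intervalIntegrable_of_locallyIntegrableOn hγ_loc ht₁' ht)
    rw [hγ0, hΓ₁] at hadd
    linarith

/-- Every optimal generator has the optimal rates in all reachable states. -/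
lemma IsOptimal.ae_eq_tiltedGenerator {r : State D N → ℝ}
    (hopt : IsOptimal T (maskGenerator D N γ) r 0 (fullMask D N) Q)
    (hN : 0 < N) (hT : 0 < T) (hγ : ∀ t ∈ Set.Ico 0 T, 0 ≤ γ t)
    (hγ_loc : LocallyIntegrableOn γ (Set.Ico 0 T) volume)
    (hγ_inf : ∫⁻ t in Set.Ico 0 T, ENNReal.ofReal (γ t) = ⊤)
    (hr : ∀ z, r (embed z) = -U z - Real.log (1 / (N : ℝ) ^ D)) :
    ∀ᵐ t ∂(volume.restrict (Set.Ico 0 T)), ∀ x,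
      (x = fullMask D N ∨ 0 < ∫ s in (0 : ℝ)..t, γ s) → ∀ y,
        Q t x y = tiltedGenerator (maskGenerator D N γ) (fun _ => potential U) t x y := by
  obtain ⟨hQ, Ω, _, P, X, hX, hleast⟩ := hopt
  have h00 : (0 : ℝ) ∈ Set.Ico 0 T := ⟨le_rfl, hT⟩
  have hQ₀ : IsGenerator T (maskGenerator D N γ) := isGenerator_maskGenerator hγ hγ_loc
  have hQs := isGenerator_tiltedGenerator (D := D) (N := N) hγ hγ_loc (potential U)
  have hcost := hleast.unique
    (isLeast_attainableCosts hN h00 hγ hγ_loc hγ_inf hr (fullMask D N))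
  rw [hX.controlCost_eq hT.le] at hcost
  have hfin : runningCost T (maskGenerator D N γ) 0 Q P X ≠ ⊤ := by
    intro h
    rw [h, EReal.coe_ennreal_top, EReal.top_sub_coe] at hcost
    exact EReal.coe_ne_top _ hcost.symm
  have h0 := hX.mean_card_masked_eq_zero hN h00 hγ hγ_loc hγ_inf hQ hfin
  have hrV : mean P X r T = mean P X (potential U) T :=
    mean_congr_of_mean_card_masked h0 fun z => by rw [hr, potential_embed]
  rw [← ENNReal.ofReal_toReal hfin, EReal.coe_ennreal_ofReal,
    max_eq_left ENNReal.toReal_nonneg, ← EReal.coe_sub, EReal.coe_eq_coe_iff, hrV] at hcost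
  have hoff := hX.ae_eq_tilted hQ hQ₀ le_rfl hT (potential U)
    (fun t _ x => expDrift_potential hN γ U t x) hfin (by linarith)
  have hae : ∀ᵐ t ∂(volume.restrict (Set.Ico 0 T)), ∀ x, 0 < P.real {ω | X t ω = x} →
      ∀ y, Q t x y = tiltedGenerator (maskGenerator D N γ) (fun _ => potential U) t x y := by
    filter_upwards [hoff, ae_restrict_mem measurableSet_Ico] with t h1 ht x hx
    refine eq_of_offDiag_eq (hQ.row_sum t ht x) (hQs.row_sum t ht x) fun y hy => ?_
    rw [h1 x hx y hy, tiltedGenerator_of_ne _ _ _ hy]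
  -- Agreement in occupied states implies that all states covered by the claim are occupied, and so
  -- agreement holds in all of them.
  filter_upwards [hae, ae_restrict_mem measurableSet_Ico] with t h1 ht x hx
  exact h1 x (hX.prob_pos hN hγ hγ_loc hae x ht hx)

end Uniqueness

end MaskedDiffusion

open MaskedDiffusion in
theorem mainTheorem3 (D N : ℕ) (hN : 0 < N) (T : ℝ) (hT : 0 < T)
    -- the noise schedule, with infinite total mass
    (γ : ℝ → ℝ) (hγ : ∀ t ∈ Set.Ico 0 T, 0 ≤ γ t)
    (hγ_loc : LocallyIntegrableOn γ (Set.Ico 0 T) volume)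
    (hγ_inf : ∫⁻ t in Set.Ico 0 T, ENNReal.ofReal (γ t) = ⊤)
    (U : (Fin D → Fin N) → ℝ)
    -- the terminal reward `-U - log p_unif`, extended arbitrarily to sequences with masks
    (r : State D N → ℝ) (hr : ∀ z, r (embed z) = -U z - Real.log (1 / (N : ℝ) ^ D)) :
    -- the reference chain exists, is memoryless, and ends in the uniform distribution
    ((∃ (Ω : Type) (_ : MeasurableSpace Ω) (P : Measure Ω) (X : ℝ → Ω → State D N),
        IsCTMC T (maskGenerator D N γ) 0 (fullMask D N) P X) ∧
      ∀ (Ω : Type) (_ : MeasurableSpace Ω) (P : Measure Ω) (X : ℝ → Ω → State D N),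
        IsCTMC T (maskGenerator D N γ) 0 (fullMask D N) P X →
          (∀ x y, P.real ({ω | X 0 ω = x} ∩ {ω | X T ω = y})
            = P.real {ω | X 0 ω = x} * P.real {ω | X T ω = y}) ∧
          ∀ z, P.real {ω | X T ω = embed z} = 1 / (N : ℝ) ^ D) ∧
    -- the value function is finite
    ∃ V : ℝ → State D N → ℝ,
      (∀ t ∈ Set.Ico 0 T, ∀ x,
        (V t x : EReal) = valueFunction T (maskGenerator D N γ) r t x) ∧
      -- the formula for the optimal generator
      (∀ t ∈ Set.Ico 0 T, ∀ x d n, setToken x d n ≠ x →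
        tiltedGenerator (maskGenerator D N γ) V t x (setToken x d n)
          = γ t * condMarginal U x d n * (if x d = none then 1 else 0)) ∧
      (∀ t ∈ Set.Ico 0 T, ∀ x y, x ≠ y → (∀ d n, y ≠ setToken x d n) →
        tiltedGenerator (maskGenerator D N γ) V t x y = 0) ∧
      -- it is optimal, from every initial time and state
      (∀ t ∈ Set.Ico 0 T, ∀ x, IsOptimal T (maskGenerator D N γ) r t x
        (tiltedGenerator (maskGenerator D N γ) V)) ∧
      -- every optimal generator agrees with it, at almost every time and every reachable state
      (∀ Q, IsOptimal T (maskGenerator D N γ) r 0 (fullMask D N) Q →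
        ∀ᵐ t ∂(volume.restrict (Set.Ico 0 T)), ∀ x,
          (x = fullMask D N ∨ 0 < ∫ s in (0 : ℝ)..t, γ s) →
            ∀ y, Q t x y = tiltedGenerator (maskGenerator D N γ) V t x y) := by
  have h00 : (0 : ℝ) ∈ Set.Ico 0 T := ⟨le_rfl, hT⟩
  refine ⟨⟨?_, fun Ω _ P X hX => ⟨fun x y => hX.indep_start x y T,
    hX.uniform_terminal hN hT hγ hγ_loc hγ_inf⟩⟩, fun _ => potential U,
    fun t ht x => (valueFunction_eq hN ht hγ hγ_loc hγ_inf hr x).symm,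
    fun t _ x d n h => tiltedGenerator_formula hN γ U t x d n h,
    fun t _ x y hxy h => tiltedGenerator_eq_zero γ _ t hxy.symm fun d n _ => h d n,
    fun t ht x => isOptimal_tiltedGenerator hN ht hγ hγ_loc hγ_inf hr x,
    fun Q hQ => hQ.ae_eq_tiltedGenerator hN hT hγ hγ_loc hγ_inf hr⟩
  -- For constant energy the potential is constant and the tilt trivial, so the unmasking chain
  -- realizes the reference generator.
  have hX := isCTMC_unmaskPath hN hγ hγ_loc hγ_inf (fun _ => 0) h00 (fullMask D N)
  rw [tiltedGenerator_potential_zero hN] at hX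
  exact ⟨_, _, _, _, hX⟩
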